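/- All matroids are finite and may have loops. Let $\mathrm{QSym}$ be the $\mathbb{Q}$-algebra of quasisymmetric functions in the variables $x_1,x_2,\dots$, with monomial basis $\mathbf{x}^{\alpha}=\sum_{i_1<\cdots<i_k}x_{i_1}^{\alpha_1}\cdots x_{i_k}^{\alpha_k}$ and fundamental basis $L_\alpha=\sum_{\beta}\mathbf{x}^\beta$ (the sum is over all compositions $\beta$ refining $\alpha$), and let $\mathfrak{m}=\bigoplus_{d\ge 1}\mathrm{QSym}_d$ be the ideal of quasisymmetric functions without constant term. For a finite poset $P$ whose elements are labeled by distinct positive integers, put $F(P)=\sum_{\pi}L_{C(\pi)}$, where $\pi$ runs over the words of labels of the linear extensions of $P$ and $C(\pi)$ is the composition of lengths of the successive increasing runs of $\pi$. For a base $B$ of a matroid $M$ with ground set $E(M)$, let $P_B$ be the poset on $E(M)$ with $e<e'$ if and only if $e\in B$, $e'\notin B$ and $(B\setminus\{e\})\cup\{e'\}$ is a base of $M$, labeled strictly (that is, $e<e'$ in $P_B$ implies that the label of $e$ is larger than that of $e'$; the choice of such a labeling does not matter). Put $F(M)=\sum_{B}F(P_B)$, the sum over all bases $B$ of $M$. Let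 $\mathrm{Mat}$ be the $\mathbb{Q}$-vector space having as a basis the isomorphism classes $[M]$ of matroids, and let $F:\mathrm{Mat}\to\mathrm{QSym}$ be the linear map with $[M]\mapsto F(M)$. A matroid is connected if its ground set is non-empty and any two distinct elements lie in a common circuit. Let $\mathrm{Mat}_c\subseteq\mathrm{Mat}$ be the subspace spanned by the isomorphism classes of connected matroids, and let $\overline{F}:\mathrm{Mat}_c\to\mathrm{QSym}/\mathfrak{m}^2$ be the linear map induced by $F$. **Proposition.** Let $\mathcal{M}^2$ be the set of isomorphism classes of rank two matroids (including those with loops), and let $\mathcal{M}^2_c$ be the set of isomorphism classes of connected rank two matroids. Then $F:\mathrm{Mat}\to\mathrm{QSym}$ is injective when restricted to $\mathcal{M}^2$, and $\overline{F}:\mathrm{Mat}_c\to\mathrm{QSym}/\mathfrak{m}^2$ is injective when restricted to $\mathcal{M}^2_c$. -/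

import Mathlib

universe u

namespace MatroidQSym

noncomputable section

open Finset

/-! ### Quasisymmetric functions over the rationals -/

/-- The list of nonzero exponents of the monomial with exponent vector `e`, read in increasing
order of the variables: for `x_{i₁}^{a₁} ⋯ x_{i_k}^{a_k}` with `i₁ < ⋯ < i_k` and all `a_j > 0`,
this is `[a₁, …, a_k]`. -/
def exponentList {ι : Type*} [LinearOrder ι] (e : ι →₀ ℕ) : List ℕ :=
  e.support.sort.map e

/-- A power series in the linearly ordered variables `x₀, x₁, x₂, …` is quasisymmetric if it has
bounded degree and, for all `a₁, …, a_k > 0`, `i₁ < ⋯ < i_k` and `j₁ < ⋯ < j_k`, the coefficients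
of `x_{i₁}^{a₁} ⋯ x_{i_k}^{a_k}` and of `x_{j₁}^{a₁} ⋯ x_{j_k}^{a_k}` agree. -/
def IsQuasisymmetric (f : MvPowerSeries ℕ ℚ) : Prop :=
  (∃ d : ℕ, ∀ e : ℕ →₀ ℕ, d < e.degree → MvPowerSeries.coeff e f = 0) ∧
    ∀ e e' : ℕ →₀ ℕ, exponentList e = exponentList e' →
      MvPowerSeries.coeff e f = MvPowerSeries.coeff e' f

theorem exponentList_embDomain {k : ℕ} (φ : Fin k ↪o ℕ) (a : Fin k →₀ ℕ) :
    exponentList (a.embDomain φ.toEmbedding) = exponentList a := by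
  unfold exponentList
  rw [Finsupp.support_embDomain]
  have h : (a.support.map φ.toEmbedding).sort = a.support.sort.map φ := by
    exact (Finset.map_sort φ.toEmbedding a.support (· ≤ ·) (· ≤ ·)
      fun x _ y _ => φ.le_iff_le.symm).symm
  rw [h, List.map_map]
  refine List.map_congr_left fun x _ => ?_
  exact Finsupp.embDomain_apply_self φ.toEmbedding a x

theorem exponentList_eq_nil {ι : Type*} [LinearOrder ι] {e : ι →₀ ℕ} :
    exponentList e = [] ↔ e = 0 := by
  unfold exponentList
  rw [List.map_eq_nil_iff, ← List.length_eq_zero_iff, Finset.length_sort, Finset.card_eq_zero,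
    Finsupp.support_eq_empty]

theorem exists_embDomain_of_exponentList_eq {e e' : ℕ →₀ ℕ}
    (h : exponentList e = exponentList e') :
    ∃ (k : ℕ) (a : Fin k →₀ ℕ) (φ ψ : Fin k ↪o ℕ),
      e = a.embDomain φ.toEmbedding ∧ e' = a.embDomain ψ.toEmbedding := by
  have hc : e.support.card = e'.support.card := by
    have := congrArg List.length h
    simpa [exponentList] using this
  let φ : Fin e.support.card ↪o ℕ := e.support.orderEmbOfFin rfl
  let ψ : Fin e.support.card ↪o ℕ := e'.support.orderEmbOfFin hc.symm
  have hval : ∀ t, e (φ t) = e' (ψ t) := by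
    intro t
    have h1 : (exponentList e)[(t : ℕ)]? = (exponentList e')[(t : ℕ)]? := by rw [h]
    have ht' : (t : ℕ) < e'.support.card := hc ▸ t.2
    simpa [exponentList, φ, ψ, Finset.orderEmbOfFin_apply, t.2, ht'] using h1
  have ha : ∀ t, (Finsupp.equivFunOnFinite.symm fun t => e (φ t)) t = e (φ t) := fun _ => rfl
  refine ⟨e.support.card, Finsupp.equivFunOnFinite.symm fun t => e (φ t), φ, ψ, ?_, ?_⟩
  · ext x
    by_cases hx : x ∈ Set.range φ
    · obtain ⟨t, rfl⟩ := hx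
      rw [← ha]
      exact (Finsupp.embDomain_apply_self φ.toEmbedding _ t).symm
    · rw [Finsupp.embDomain_of_notMem_range _ _ _ hx]
      have : x ∉ e.support := by
        intro hx'
        apply hx
        rw [show Set.range φ = _ from Finset.range_orderEmbOfFin e.support rfl]
        exact hx'
      simpa using this
  · ext x
    by_cases hx : x ∈ Set.range ψ
    · obtain ⟨t, rfl⟩ := hx
      rw [← hval, ← ha]
      exact (Finsupp.embDomain_apply_self ψ.toEmbedding _ t).symm
    · rw [Finsupp.embDomain_of_notMem_range _ _ _ hx]
      have : x ∉ e'.support := by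
        intro hx'
        apply hx
        rw [show Set.range ψ = _ from Finset.range_orderEmbOfFin e'.support hc.symm]
        exact hx'
      simpa using this

theorem coeff_mul_embDomain (f g : MvPowerSeries ℕ ℚ) {k : ℕ} (a : Fin k →₀ ℕ)
    (φ : Fin k ↪o ℕ) :
    MvPowerSeries.coeff (a.embDomain φ.toEmbedding) (f * g) =
      ∑ p ∈ Finset.HasAntidiagonal.antidiagonal a, MvPowerSeries.coeff (p.1.embDomain φ.toEmbedding) f *
        MvPowerSeries.coeff (p.2.embDomain φ.toEmbedding) g := by
  classical
  rw [MvPowerSeries.coeff_mul, ← Finsupp.image_prodMap_embDomain_antidiagonal,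
    Finset.sum_image]
  · rfl
  · intro p _ q _ hpq
    have h := Prod.ext_iff.1 hpq
    exact Prod.ext (Finsupp.embDomain_injective _ h.1) (Finsupp.embDomain_injective _ h.2)

theorem IsQuasisymmetric.mul {f g : MvPowerSeries ℕ ℚ} (hf : IsQuasisymmetric f)
    (hg : IsQuasisymmetric g) : IsQuasisymmetric (f * g) := by
  classical
  obtain ⟨⟨d, hd⟩, hf⟩ := hf
  obtain ⟨⟨d', hd'⟩, hg⟩ := hg
  refine ⟨⟨d + d', fun e he => ?_⟩, fun e e' h => ?_⟩
  · rw [MvPowerSeries.coeff_mul]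
    refine Finset.sum_eq_zero fun p hp => ?_
    rw [Finset.HasAntidiagonal.mem_antidiagonal] at hp
    have hdeg : e.degree = p.1.degree + p.2.degree := by rw [← hp, map_add]
    rcases lt_or_ge d p.1.degree with h1 | h1
    · rw [hd _ h1, zero_mul]
    · rw [hd' _ (by omega), mul_zero]
  · obtain ⟨k, a, φ, ψ, rfl, rfl⟩ := exists_embDomain_of_exponentList_eq h
    rw [coeff_mul_embDomain, coeff_mul_embDomain]
    refine Finset.sum_congr rfl fun p _ => ?_
    rw [hf (p.1.embDomain φ.toEmbedding) (p.1.embDomain ψ.toEmbedding)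
        (by rw [exponentList_embDomain, exponentList_embDomain]),
      hg (p.2.embDomain φ.toEmbedding) (p.2.embDomain ψ.toEmbedding)
        (by rw [exponentList_embDomain, exponentList_embDomain])]

/-- The ring of quasisymmetric functions with rational coefficients. -/
def QSym : Subalgebra ℚ (MvPowerSeries ℕ ℚ) where
  carrier := {f | IsQuasisymmetric f}
  mul_mem' := IsQuasisymmetric.mul
  add_mem' := by
    rintro f g ⟨⟨d, hd⟩, hf⟩ ⟨⟨d', hd'⟩, hg⟩
    refine ⟨⟨max d d', fun e he => ?_⟩, fun e e' h => ?_⟩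
    · rw [map_add, hd e (lt_of_le_of_lt (le_max_left _ _) he),
        hd' e (lt_of_le_of_lt (le_max_right _ _) he), add_zero]
    · rw [map_add, map_add, hf e e' h, hg e e' h]
  algebraMap_mem' := by
    classical
    intro r
    refine ⟨⟨0, fun e he => ?_⟩, fun e e' h => ?_⟩
    · rw [MvPowerSeries.algebraMap_apply, MvPowerSeries.coeff_C, if_neg]
      rintro rfl
      simp at he
    · rw [MvPowerSeries.algebraMap_apply, MvPowerSeries.coeff_C, MvPowerSeries.coeff_C]
      have : e = 0 ↔ e' = 0 := by
        rw [← exponentList_eq_nil, ← exponentList_eq_nil, h]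
      simp only [this]

/-- The ideal `𝔪 = ⨁_{d ≥ 1} QSym_d` of the quasisymmetric functions without constant term. -/
def maximalIdeal : Ideal QSym :=
  RingHom.ker ((MvPowerSeries.constantCoeff (σ := ℕ) (R := ℚ)).comp QSym.val.toRingHom)

/-- The monomial quasisymmetric function `∑_{i₁ < ⋯ < i_k} x_{i₁}^{α₁} ⋯ x_{i_k}^{α_k}` of a
composition `α` of `n`. -/
def monomialQSym {n : ℕ} (α : Composition n) : QSym :=
  ⟨fun e => if exponentList e = α.blocks then 1 else 0, by
    refine ⟨⟨n, fun e he => ?_⟩, fun e e' h => ?_⟩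
    · change (if exponentList e = α.blocks then (1 : ℚ) else 0) = 0
      rw [if_neg]
      intro h
      have h1 : (exponentList e).sum = n := by rw [h, α.blocks_sum]
      have h2 : (exponentList e).sum = e.degree := by
        unfold exponentList
        rw [Finsupp.degree_apply, ← Multiset.sum_coe, ← Multiset.map_coe, Finset.sort_eq]
        rfl
      omega
    · change (if exponentList e = α.blocks then (1 : ℚ) else 0) =
        if exponentList e' = α.blocks then (1 : ℚ) else 0
      rw [h]⟩

/-- The fundamental quasisymmetric function `L_α`, the sum of the monomial quasisymmetric functions
of the refinements `β` of `α`, i.e. of the `β` whose set of partial sums contains that of `α`. -/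
def fundamentalQSym {n : ℕ} (α : Composition n) : QSym :=
  ∑ β ∈ univ.filter (fun β : Composition n => α.boundaries ⊆ β.boundaries), monomialQSym β

/-- The composition `C(w)` of the lengths of the successive increasing runs of a word `w`
with distinct letters: a new run starts exactly after each descent of `w`. -/
def runComposition {n : ℕ} (w : Fin n → ℕ) : Composition n :=
  CompositionAsSet.toComposition
    { boundaries := univ.filter fun b : Fin (n + 1) => b = 0 ∨ b = Fin.last n ∨
        ∃ i j : Fin n, (i : ℕ) + 1 = b ∧ (j : ℕ) = b ∧ w j < w i
      zero_mem := by simp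
      getLast_mem := by simp }

/-! ### Labeled posets -/

section Poset

variable {E E' : Type*}

/-- The one-line notation `π` lists the elements of `E` in an order extending the partial
order `P`. -/
def IsLinearExtension {n : ℕ} (P : PartialOrder E) (π : Fin n ≃ E) : Prop :=
  ∀ i j : Fin n, P.lt (π i) (π j) → i < j

/-- `γ` labels the elements by distinct numbers, larger elements getting smaller labels. -/
def IsStrictLabeling (P : PartialOrder E) (γ : E → ℕ) : Prop :=
  Function.Injective γ ∧ ∀ x y : E, P.lt x y → γ y < γ x

open Classical in
/-- The sum of `L_{C(w)}` over the label words `w` of the linear extensions of the labeled poset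
`(P, γ)`, where `n` is the number of elements. -/
def posetQSymAux (n : ℕ) [Finite E] (P : PartialOrder E) (γ : E → ℕ) : QSym :=
  letI : Fintype E := Fintype.ofFinite E
  ∑ π ∈ univ.filter (fun π : Fin n ≃ E => IsLinearExtension P π),
    fundamentalQSym (runComposition (γ ∘ π))

/-- The quasisymmetric function `F(P) = ∑_{π ∈ 𝓛(P)} L_{C(π)}` of a finite labeled poset. -/
def posetQSym [Finite E] (P : PartialOrder E) (γ : E → ℕ) : QSym :=
  posetQSymAux (Nat.card E) P γ

/-! The function of a strictly labeled poset depends on the unlabeled poset only. -/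

/-- Position of `i` among the blocks cut out by the boundary set `D`. -/
def blockOf {n : ℕ} (D : Finset (Fin (n + 1))) (i : Fin n) : ℕ :=
  #(D.filter (· ≤ i.castSucc))

theorem blockOf_mono {n : ℕ} (D : Finset (Fin (n + 1))) : Monotone (blockOf D) := by
  intro i j hij
  refine Finset.card_le_card fun b hb => ?_
  rw [mem_filter] at hb ⊢
  exact ⟨hb.1, hb.2.trans (Fin.castSucc_le_castSucc_iff.2 hij)⟩

theorem blockOf_lt {n : ℕ} {D : Finset (Fin (n + 1))} {i j : Fin n} {b : Fin (n + 1)}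
    (hb : b ∈ D) (h1 : i.castSucc < b) (h2 : b ≤ j.castSucc) : blockOf D i < blockOf D j := by
  refine Finset.card_lt_card ?_
  rw [Finset.ssubset_iff_of_subset]
  · exact ⟨b, by simp [hb, h2], by simp [h1]⟩
  · intro c hc
    rw [mem_filter] at hc ⊢
    exact ⟨hc.1, hc.2.trans (h1.le.trans h2)⟩

theorem blockOf_eq_of {n : ℕ} {D : Finset (Fin (n + 1))} {i j : Fin n} (hij : i ≤ j)
    (h : ∀ b ∈ D, i.castSucc < b → ¬ b ≤ j.castSucc) : blockOf D i = blockOf D j := by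
  unfold blockOf
  congr 1
  ext b
  rw [mem_filter, mem_filter]
  refine and_congr_right fun hb => ⟨fun h' => h'.trans (Fin.castSucc_le_castSucc_iff.2 hij),
    fun h' => ?_⟩
  by_contra hlt
  exact h b hb (not_le.1 hlt) h'

/-- The word `w` is increasing on each block of `β` iff `β` refines its run composition. -/
theorem refines_iff {n : ℕ} (w : Fin n → ℕ) (hw : Function.Injective w) (β : Composition n) :
    (runComposition w).boundaries ⊆ β.boundaries ↔
      ∀ i j : Fin n, i < j → blockOf β.boundaries i = blockOf β.boundaries j → w i < w j := by
  rw [runComposition, CompositionAsSet.toComposition_boundaries]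
  constructor
  · intro h i j hij heq
    have key : ∀ m : ℕ, ∀ i j : Fin n, (i : ℕ) + m + 1 = j →
        blockOf β.boundaries i = blockOf β.boundaries j → w i < w j := by
      intro m
      induction m with
      | zero =>
        intro i j hij heq
        by_contra hlt
        have hne : w i ≠ w j := fun h => by
          have := congrArg Fin.val (hw h)
          omega
        have hd : w j < w i := lt_of_le_of_ne (not_lt.1 hlt) hne.symm
        have hmem : j.castSucc ∈ β.boundaries := by
          apply h
          rw [mem_filter]
          exact ⟨mem_univ _, Or.inr (Or.inr ⟨i, j, by simpa using hij, rfl, hd⟩)⟩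
        have := blockOf_lt (i := i) (j := j) hmem
          (by rw [Fin.lt_def]; simp; omega) le_rfl
        omega
      | succ m ih =>
        intro i j hij heq
        let l : Fin n := ⟨i + m + 1, by omega⟩
        have h1 : blockOf β.boundaries i ≤ blockOf β.boundaries l :=
          blockOf_mono _ (by rw [Fin.le_def]; simp [l]; omega)
        have h2 : blockOf β.boundaries l ≤ blockOf β.boundaries j :=
          blockOf_mono _ (by rw [Fin.le_def]; simp [l]; omega)
        have h3 : w i < w l := ih i l rfl (by omega)
        refine h3.trans ?_
        by_contra hlt
        have hne : w l ≠ w j := fun h => by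
          have := congrArg Fin.val (hw h)
          simp [l] at this
          omega
        have hd : w j < w l := lt_of_le_of_ne (not_lt.1 hlt) hne.symm
        have hmem : j.castSucc ∈ β.boundaries := by
          apply h
          rw [mem_filter]
          exact ⟨mem_univ _, Or.inr (Or.inr ⟨l, j, by simp [l]; omega, rfl, hd⟩)⟩
        have := blockOf_lt (i := l) (j := j) hmem
          (by rw [Fin.lt_def]; simp [l]; omega) le_rfl
        omega
    have hij' : (i : ℕ) < j := hij
    exact key (j - i - 1) i j (by omega) heq
  · intro h b hb
    rw [mem_filter] at hb
    rcases hb.2 with rfl | rfl | ⟨i, j, hi, hj, hd⟩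
    · exact β.toCompositionAsSet.zero_mem
    · exact β.toCompositionAsSet.getLast_mem
    · by_contra hnb
      have hij : i < j := by rw [Fin.lt_def]; omega
      refine absurd (h i j hij (blockOf_eq_of hij.le fun c hc h1 h2 => hnb ?_)) (not_lt.2 hd.le)
      have : c = b := by
        rw [Fin.lt_def] at h1
        rw [Fin.le_def] at h2
        simp at h1 h2
        ext
        omega
      exact this ▸ hc

/-- The linear extensions of `P` whose label word is increasing on the blocks of `D`. -/
def goodSet {n : ℕ} (P : PartialOrder E) (γ : E → ℕ) (D : Finset (Fin (n + 1))) :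
    Set (Fin n ≃ E) :=
  {π | IsLinearExtension P π ∧
    ∀ i j : Fin n, i < j → blockOf D i = blockOf D j → γ (π i) < γ (π j)}

theorem goodSet_injOn {n : ℕ} (P : PartialOrder E) (γ : E → ℕ) (D : Finset (Fin (n + 1))) :
    Set.InjOn (fun (π : Fin n ≃ E) (x : E) => blockOf D (π.symm x)) (goodSet P γ D) := by
  intro π hπ π' hπ' h
  have hb : ∀ i, blockOf D (π'.symm (π i)) = blockOf D i := fun i => by
    have := congrFun h (π i)
    simpa using this.symm
  have hmono : StrictMono fun i => π'.symm (π i) := by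
    intro i j hij
    by_contra hlt
    have hne : π'.symm (π j) ≠ π'.symm (π i) := fun h => hij.ne' (by simpa using h)
    have hlt' : π'.symm (π j) < π'.symm (π i) := lt_of_le_of_ne (not_lt.1 hlt) hne
    have h1 : blockOf D j ≤ blockOf D i := by
      rw [← hb i, ← hb j]
      exact blockOf_mono D hlt'.le
    have h2 : blockOf D i = blockOf D j := le_antisymm (blockOf_mono D hij.le) h1
    have h3 := hπ.2 i j hij h2
    have h4 := hπ'.2 _ _ hlt' (by rw [hb, hb, h2])
    simp at h4
    omega
  have hid : (StrictMono.orderIsoOfSurjective _ hmono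
      ((π.trans π'.symm).surjective)) = OrderIso.refl (Fin n) := Subsingleton.elim _ _
  ext i
  have := congrArg (fun f : Fin n ≃o Fin n => f i) hid
  have h5 : π'.symm (π i) = i := this
  exact (π'.symm_apply_eq.1 h5)

theorem exists_sorting {n : ℕ} (τ : Fin n ≃ E) (key : E → ℕ ×ₗ ℕ) (hkey : Function.Injective key) :
    ∃ π : Fin n ≃ E, ∀ i j, i < j ↔ key (π i) < key (π j) := by
  let _ : LinearOrder E := LinearOrder.lift' key hkey
  let _ : Fintype E := Fintype.ofEquiv _ τ
  have hcard : Fintype.card E = n := by simpa using (Fintype.card_congr τ).symm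
  let π : Fin n ≃o E := Fintype.orderIsoFinOfCardEq E hcard
  exact ⟨π.toEquiv, fun i j => π.lt_iff_lt.symm⟩

theorem goodSet_image {n : ℕ} (P : PartialOrder E) (γ : E → ℕ) (hγ : IsStrictLabeling P γ)
    (D : Finset (Fin (n + 1))) :
    (fun (π : Fin n ≃ E) (x : E) => blockOf D (π.symm x)) '' goodSet P γ D =
      {f : E → ℕ | (∀ x y, P.lt x y → f x < f y) ∧
        ∃ τ : Fin n ≃ E, ∀ i, f (τ i) = blockOf D i} := by
  ext f
  constructor
  · rintro ⟨π, hπ, rfl⟩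
    refine ⟨fun x y hxy => ?_, π, fun i => by simp⟩
    have h1 : π.symm x < π.symm y := hπ.1 _ _ (by simpa using hxy)
    refine lt_of_le_of_ne (blockOf_mono D h1.le) fun heq => ?_
    have h2 := hπ.2 _ _ h1 heq
    have h3 := hγ.2 x y hxy
    simp at h2
    omega
  · rintro ⟨hf, τ, hτ⟩
    let key : E → ℕ ×ₗ ℕ := fun x => toLex (f x, γ x)
    have hkey : Function.Injective key := by
      intro x y h
      have h' : (f x, γ x) = (f y, γ y) := toLex.injective h
      exact hγ.1 (Prod.ext_iff.1 h').2
    obtain ⟨π, hlt⟩ := exists_sorting τ key hkey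
    have hmono : Monotone fun i => f (π i) := by
      intro i j hij
      rcases hij.eq_or_lt with rfl | h
      · exact le_rfl
      · have := (hlt i j).1 h
        rcases Prod.Lex.toLex_lt_toLex.1 this with h | h
        · exact h.le
        · exact h.1.le
    have hfb : ∀ i, f (π i) = blockOf D i := by
      have h1 : Monotone (blockOf D ∘ (Equiv.refl (Fin n) : Equiv.Perm (Fin n))) :=
        blockOf_mono D
      have h2 : (fun i => f (π i)) = blockOf D ∘ (π.trans τ.symm : Equiv.Perm (Fin n)) := by
        funext i
        simp [← hτ]
      have h3 := Tuple.unique_monotone (h2 ▸ hmono) h1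
      intro i
      have := congrFun (h2.trans h3) i
      simpa using this
    refine ⟨π, ⟨fun i j hij => ?_, fun i j hij heq => ?_⟩, ?_⟩
    · rw [hlt]
      exact Prod.Lex.toLex_lt_toLex.2 (Or.inl (hf _ _ hij))
    · have := (hlt i j).1 hij
      rcases Prod.Lex.toLex_lt_toLex.1 this with h | h
      · have h' : f (π i) < f (π j) := h
        rw [hfb, hfb] at h'
        omega
      · exact h.2
    · funext x
      have := hfb (π.symm x)
      simpa using this.symm

theorem posetQSymAux_eq (n : ℕ) [Finite E] (P : PartialOrder E) (γ : E → ℕ)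
    (hγ : Function.Injective γ) :
    posetQSymAux n P γ =
      ∑ β : Composition n, (goodSet P γ β.boundaries).ncard • monomialQSym β := by
  classical
  let _ : Fintype E := Fintype.ofFinite E
  have h1 : ∀ β : Composition n, (goodSet P γ β.boundaries).ncard • monomialQSym β =
      ∑ π ∈ univ.filter (fun π : Fin n ≃ E => IsLinearExtension P π),
        if (runComposition (γ ∘ π)).boundaries ⊆ β.boundaries then monomialQSym β else 0 := by
    intro β
    have h2 : goodSet P γ β.boundaries = ((univ.filter fun π : Fin n ≃ E =>
        IsLinearExtension P π).filter fun π =>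
          (runComposition (γ ∘ π)).boundaries ⊆ β.boundaries : Finset (Fin n ≃ E)) := by
      ext π
      simp only [goodSet, Set.mem_ofPred_eq, Finset.coe_filter, mem_filter, mem_univ, true_and]
      rw [refines_iff _ (hγ.comp π.injective)]
      rfl
    rw [h2, Set.ncard_coe_finset, ← Finset.sum_filter, Finset.sum_const]
  rw [Finset.sum_congr rfl fun β _ => h1 β, Finset.sum_comm]
  unfold posetQSymAux fundamentalQSym
  simp_rw [Finset.sum_filter]

/-- The function of a strictly labeled poset is invariant under isomorphisms of the unlabeled
poset, and so does not depend on the strict labeling. -/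
theorem posetQSym_congr [Finite E] [Finite E'] (P : PartialOrder E) (P' : PartialOrder E')
    {γ : E → ℕ} {γ' : E' → ℕ} (hγ : IsStrictLabeling P γ) (hγ' : IsStrictLabeling P' γ')
    (e : E ≃ E') (he : ∀ x y, P.lt x y ↔ P'.lt (e x) (e y)) :
    posetQSym P γ = posetQSym P' γ' := by
  unfold posetQSym
  rw [← Nat.card_congr e, posetQSymAux_eq _ P γ hγ.1, posetQSymAux_eq _ P' γ' hγ'.1]
  refine Finset.sum_congr rfl fun β _ => ?_
  rw [← (goodSet_injOn P γ β.boundaries).ncard_image,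
    ← (goodSet_injOn P' γ' β.boundaries).ncard_image,
    goodSet_image P γ hγ, goodSet_image P' γ' hγ']
  congr 1
  refine Set.ncard_congr' ((Equiv.arrowCongr e (Equiv.refl ℕ)).subtypeEquiv fun f => ?_)
  simp only [Set.mem_ofPred_eq, Equiv.arrowCongr_apply, Equiv.coe_refl, Function.comp_apply, id]
  refine and_congr ⟨fun h x y hxy => h _ _ ?_, fun h x y hxy => ?_⟩
    ⟨fun ⟨τ, hτ⟩ => ⟨τ.trans e, by simpa using hτ⟩,
      fun ⟨τ, hτ⟩ => ⟨τ.trans e.symm, by simpa using hτ⟩⟩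
  · rw [he]
    simpa using hxy
  · simpa using h _ _ ((he x y).1 hxy)

end Poset

/-! ### The quasisymmetric function of a matroid -/

section Matroid

variable {α β : Type*}

/-- The poset `P_B` on the ground set: `e < e'` iff `e ∈ B`, `e' ∉ B` and `(B - e) ∪ {e'}` is a
base of `M`. -/
@[reducible] def basePoset (M : Matroid α) (B : Set α) : PartialOrder M.E where
  lt x y := (x : α) ∈ B ∧ (y : α) ∉ B ∧ M.IsBase (insert (y : α) (B \ {(x : α)}))
  le x y := x = y ∨ ((x : α) ∈ B ∧ (y : α) ∉ B ∧ M.IsBase (insert (y : α) (B \ {(x : α)})))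
  le_refl x := Or.inl rfl
  le_trans := by
    rintro x y z (rfl | h) (rfl | h')
    · exact Or.inl rfl
    · exact Or.inr h'
    · exact Or.inr h
    · exact absurd h'.1 h.2.1
  le_antisymm := by
    rintro x y (rfl | h) (h' | h')
    · rfl
    · rfl
    · exact h'.symm
    · exact absurd h'.1 h.2.1
  lt_iff_le_not_ge := by
    intro x y
    constructor
    · intro h
      refine ⟨Or.inr h, ?_⟩
      rintro (rfl | h')
      · exact h.2.1 h.1
      · exact h.2.1 h'.1
    · rintro ⟨rfl | h, h'⟩
      · exact absurd (Or.inl rfl) h'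
      · exact h

theorem exists_strictLabeling (M : Matroid α) [M.Finite] (B : Set α) :
    ∃ γ : M.E → ℕ, IsStrictLabeling (basePoset M B) γ := by
  classical
  have : Finite M.E := M.ground_finite.to_subtype
  let e := Finite.equivFin M.E
  refine ⟨fun x => if (x : α) ∈ B then Nat.card M.E + e x else e x, fun x y h => ?_,
    fun x y h => ?_⟩
  · have h1 := (e x).2
    have h2 := (e y).2
    apply e.injective
    ext
    dsimp only at h
    split_ifs at h <;> omega
  · have h1 := (e y).2
    simp only [if_pos h.1, if_neg h.2.1]
    omega

/-- Some strict labeling of `P_B`. -/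
def baseLabeling (M : Matroid α) [M.Finite] (B : Set α) : M.E → ℕ :=
  Classical.choose (exists_strictLabeling M B)

theorem baseLabeling_strict (M : Matroid α) [M.Finite] (B : Set α) :
    IsStrictLabeling (basePoset M B) (baseLabeling M B) :=
  Classical.choose_spec (exists_strictLabeling M B)

/-- The finite set of bases of a finite matroid. -/
def bases (M : Matroid α) [M.Finite] : Finset (Set α) :=
  (M.ground_finite.finite_subsets.subset
    (fun _ hB => hB.subset_ground : {B | M.IsBase B} ⊆ {X | X ⊆ M.E})).toFinset

theorem mem_bases {M : Matroid α} [M.Finite] {B : Set α} : B ∈ bases M ↔ M.IsBase B := by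
  simp [bases]

/-- The quasisymmetric function `F(M) = ∑_B F(P_B)` of a finite matroid, the sum over its bases
`B` of the functions of the strictly labeled posets `P_B`. -/
def matroidQSym (M : Matroid α) [M.Finite] : QSym :=
  haveI : Finite M.E := M.ground_finite.to_subtype
  ∑ B ∈ bases M, posetQSym (basePoset M B) (baseLabeling M B)

/-- Any choice of strict labelings gives the same function. -/
theorem matroidQSym_eq (M : Matroid α) [M.Finite] [Finite M.E] (γ : Set α → M.E → ℕ)
    (hγ : ∀ B, M.IsBase B → IsStrictLabeling (basePoset M B) (γ B)) :
    matroidQSym M = ∑ B ∈ bases M, posetQSym (basePoset M B) (γ B) :=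
  Finset.sum_congr rfl fun B hB => posetQSym_congr _ _ (baseLabeling_strict M B)
    (hγ B (mem_bases.1 hB)) (Equiv.refl _) fun _ _ => Iff.rfl

/-- Two matroids are isomorphic if some bijection between their ground sets preserves independence
in both directions. -/
def Isomorphic (M : Matroid α) (N : Matroid β) : Prop :=
  ∃ e : M.E ≃ N.E, ∀ I : Set M.E,
    M.Indep (Subtype.val '' I) ↔ N.Indep (Subtype.val '' (e '' I))

theorem Isomorphic.refl (M : Matroid α) : Isomorphic M M :=
  ⟨Equiv.refl _, fun I => by simp⟩

theorem Isomorphic.symm {M : Matroid α} {N : Matroid β} : Isomorphic M N → Isomorphic N M := by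
  rintro ⟨e, he⟩
  exact ⟨e.symm, fun I => by rw [he, e.image_symm_image]⟩

theorem Isomorphic.trans {α₁ α₂ α₃ : Type*} {M : Matroid α₁} {N : Matroid α₂} {K : Matroid α₃} :
    Isomorphic M N → Isomorphic N K → Isomorphic M K := by
  rintro ⟨e, he⟩ ⟨f, hf⟩
  exact ⟨e.trans f, fun I => by rw [he, hf, ← Set.image_comp f e I]; rfl⟩

theorem isBase_image {M : Matroid α} {N : Matroid β} (e : M.E ≃ N.E)
    (he : ∀ I : Set M.E, M.Indep (Subtype.val '' I) ↔ N.Indep (Subtype.val '' (e '' I)))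
    (I : Set M.E) (hI : M.IsBase (Subtype.val '' I)) : N.IsBase (Subtype.val '' (e '' I)) := by
  rw [Matroid.isBase_iff_maximal_indep] at hI ⊢
  refine ⟨(he I).1 hI.1, fun J hJ hIJ => ?_⟩
  obtain ⟨K, rfl⟩ : ∃ K : Set M.E, J = Subtype.val '' (e '' K) := by
    refine ⟨e ⁻¹' (Subtype.val ⁻¹' J), ?_⟩
    rw [e.image_preimage, Subtype.image_preimage_coe, Set.inter_eq_right.2 hJ.subset_ground]
  have hIK : I ⊆ K := (Set.image_subset_image_iff e.injective).1
    ((Set.image_subset_image_iff Subtype.val_injective).1 hIJ)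
  have := hI.2 ((he K).2 hJ) (Set.image_mono hIK)
  exact Set.image_mono (Set.image_mono
    ((Set.image_subset_image_iff Subtype.val_injective).1 this))

theorem matroidQSym_congr {M : Matroid α} {N : Matroid β} [M.Finite] [N.Finite]
    (h : Isomorphic M N) : matroidQSym M = matroidQSym N := by
  classical
  obtain ⟨e, he⟩ := h
  have hbase : ∀ I : Set M.E,
      M.IsBase (Subtype.val '' I) ↔ N.IsBase (Subtype.val '' (e '' I)) := fun I =>
    ⟨isBase_image e he I, fun hI => by
      have := isBase_image e.symm (fun J => by rw [he, e.image_symm_image]) _ hI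
      rwa [e.symm_image_image] at this⟩
  have : Finite M.E := M.ground_finite.to_subtype
  have : Finite N.E := N.ground_finite.to_subtype
  have hM : ∀ B, B ∈ bases M → Subtype.val '' (Subtype.val ⁻¹' B : Set M.E) = B := fun B hB => by
    rw [Subtype.image_preimage_coe, Set.inter_eq_right.2 (mem_bases.1 hB).subset_ground]
  have hN : ∀ B, B ∈ bases N → Subtype.val '' (Subtype.val ⁻¹' B : Set N.E) = B := fun B hB => by
    rw [Subtype.image_preimage_coe, Set.inter_eq_right.2 (mem_bases.1 hB).subset_ground]
  refine Finset.sum_bij'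
    (fun B _ => Subtype.val '' (e '' (Subtype.val ⁻¹' B)))
    (fun B _ => Subtype.val '' (e.symm '' (Subtype.val ⁻¹' B))) ?_ ?_ ?_ ?_ ?_
  · intro B hB
    rw [mem_bases, ← hbase, hM B hB]
    exact mem_bases.1 hB
  · intro B hB
    rw [mem_bases, hbase, e.image_symm_image, hN B hB]
    exact mem_bases.1 hB
  · intro B hB
    rw [Set.preimage_image_eq _ Subtype.val_injective, e.symm_image_image, hM B hB]
  · intro B hB
    rw [Set.preimage_image_eq _ Subtype.val_injective, e.image_symm_image, hN B hB]
  · intro B hB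
    refine posetQSym_congr _ _ (baseLabeling_strict M B) (baseLabeling_strict N _) e fun x y => ?_
    have hmem : ∀ x : M.E, ((e x : N.E) : β) ∈ Subtype.val '' (e '' (Subtype.val ⁻¹' B)) ↔
        (x : α) ∈ B := fun x => by
      rw [Subtype.val_injective.mem_set_image, e.injective.mem_set_image]
      rfl
    refine and_congr (hmem x).symm (and_congr (not_congr (hmem y).symm) ?_)
    have h1 : (insert (y : α) (B \ {(x : α)})) =
        Subtype.val '' (insert y ((Subtype.val ⁻¹' B : Set M.E) \ {x})) := by
      rw [Set.image_insert_eq, Set.image_sdiff Subtype.val_injective, hM B hB,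
        Set.image_singleton]
    rw [h1, hbase, Set.image_insert_eq, Set.image_insert_eq, Set.image_sdiff e.injective,
      Set.image_sdiff Subtype.val_injective, Set.image_singleton, Set.image_singleton]

/-- A matroid is connected if it has exactly one component, where two elements lie in the same
component iff they are equal or both contained in some circuit. -/
def IsConnected (M : Matroid α) : Prop :=
  M.E.Nonempty ∧ ∀ e ∈ M.E, ∀ f ∈ M.E, e = f ∨ ∃ C, M.IsCircuit C ∧ e ∈ C ∧ f ∈ C

end Matroid

/-! ### The space spanned by the isomorphism classes of matroids -/

/-- A matroid with finite ground set. -/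
structure FiniteMatroid : Type (u + 1) where
  /-- the ambient type -/
  carrier : Type u
  /-- the matroid -/
  matroid : Matroid carrier
  /-- its ground set is finite -/
  finite : matroid.Finite

instance (M : FiniteMatroid.{u}) : M.matroid.Finite := M.finite

instance isoSetoid : Setoid FiniteMatroid.{u} where
  r M N := Isomorphic M.matroid N.matroid
  iseqv := ⟨fun M => .refl M.matroid, fun h => h.symm, fun h h' => h.trans h'⟩

/-- The isomorphism classes of finite matroids. -/
def IsoClass : Type (u + 1) := Quotient isoSetoid.{u}

/-- The isomorphism class of a finite matroid. -/
def IsoClass.mk (M : FiniteMatroid.{u}) : IsoClass.{u} := Quotient.mk isoSetoid M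

/-- The quasisymmetric function of an isomorphism class of matroids. -/
def IsoClass.qsym : IsoClass.{u} → QSym :=
  Quotient.lift (fun M : FiniteMatroid.{u} => matroidQSym M.matroid)
    fun _ _ h => matroidQSym_congr h

/-- The vector space `Mat` having the isomorphism classes of finite matroids as a basis. -/
abbrev Mat : Type (u + 1) := IsoClass.{u} →₀ ℚ

/-- The basis element `[M]` of `Mat`. -/
def Mat.of (M : FiniteMatroid.{u}) : Mat.{u} :=
  Finsupp.single (IsoClass.mk M) 1

/-- The subspace `Mat_c` of `Mat` spanned by the isomorphism classes of connected matroids. -/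
def MatConn : Submodule ℚ Mat.{u} :=
  Submodule.span ℚ {x | ∃ M : FiniteMatroid.{u}, IsConnected M.matroid ∧ x = Mat.of M}

/-- The map `F : Mat → QSym`, the linear map with `[M] ↦ F(M)`. -/
def F : Mat.{u} →ₗ[ℚ] QSym :=
  Finsupp.linearCombination ℚ IsoClass.qsym

theorem F_of (M : FiniteMatroid.{u}) : F (Mat.of M) = matroidQSym M.matroid := by
  unfold F Mat.of
  rw [Finsupp.linearCombination_single, one_smul]
  rfl

/-- The induced map `Mat_c → QSym / 𝔪²`. -/
def Fbar : MatConn.{u} →ₗ[ℚ] QSym ⧸ maximalIdeal ^ 2 :=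
  (Ideal.Quotient.mkₐ ℚ (maximalIdeal ^ 2)).toLinearMap ∘ₗ F ∘ₗ MatConn.subtype

/-- The set of isomorphism classes of rank two matroids, possibly with loops. -/
def rankTwo : Set Mat.{u} :=
  {x | ∃ M : FiniteMatroid.{u}, M.matroid.eRank = 2 ∧ x = Mat.of M}

/-- The set of isomorphism classes of connected rank two matroids. -/
def rankTwoConn : Set MatConn.{u} :=
  {x | ∃ M : FiniteMatroid.{u}, IsConnected M.matroid ∧ M.matroid.eRank = 2 ∧ x = Mat.of M}

end

end MatroidQSym

/-! The algebra of words (noncommutative symmetric functions) is dual to QSym: pairing a word with a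
quasisymmetric function reads off a coefficient, and the coproduct for which `letterSeries` is
group-like is dual to multiplication (`pairing_mul`). A primitive element therefore pairs to zero
with 𝔪² (`pairing_eq_zero_of_mem`). The coefficients `powerSum` of the logarithmic derivative of
`letterSeries` are primitive, and so are their commutators.

The coefficients of F(P) count strictly increasing maps on P with given fiber sizes, which are
entries of products of transfer matrices indexed by subsets of P (`pairing_posetQSym`).
Inclusion-exclusion makes two families of matrices explicit: for a lower set J and I ⊆ J with d
elements in J \ I, the (I, J) entry of `signWord d` is (-1)^d, and that of `powerSum d` is -(-1)^d
or 0 according to whether J contains exactly one of the `minimals` of I. Products of these elements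
thus evaluate to signed counts of lower sets.

A rank two matroid is determined by its number of loops and the sizes of its parallel classes. In
the poset of a base {x, y}, a lower set with a single minimal element is a loop, or a subset of the
parallel class of x containing x, or the same for y. Let n be the number of elements, N the number
of nonloops, D the number of ordered bases, and ν(s) = `classCount b s`. Summing over ordered bases,
`signWord n` yields n and D, then `powerSum 1 * signWord (n - 1)` yields the number of loops, and
`powerSum a * signWord (n - a)` yields the sums of ν(s)(N - s)·choose(s - 1, a - 1), a triangular
system for ν (`invariants_eq`).

Modulo 𝔪² only primitive elements are available. Without loops, `powerSum a * powerSum c` with a + c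
= n evaluates to ±2cν(a), so commutators determine cν(a) - aν(c). A connected matroid of rank two
has at least three parallel classes, so two distinct classes have fewer than n elements together;
for a ≠ c one of ν(a), ν(c) is then zero, and the sign of the difference tells which may be nonzero.
The remaining value ν(n/2) follows from the fact that ν sums to n (`classCount_eq_of_commutator`).
-/

namespace MatroidQSym

noncomputable section

open Finset
open scoped TensorProduct

/-! ### The algebra of words, dual to the quasisymmetric functions -/

/-- The algebra of words in the natural numbers, whose product is concatenation. -/
abbrev WordAlgebra : Type := MonoidAlgebra ℚ (FreeMonoid ℕ)

/-- The word `n` as an element of the algebra of words, with the letter `0` being the empty word. -/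
def letter (n : ℕ) : WordAlgebra :=
  if n = 0 then 1 else MonoidAlgebra.of ℚ _ (FreeMonoid.of n)

theorem letter_zero : letter 0 = 1 := if_pos rfl

/-- The algebra homomorphism that takes given values on the letters. -/
def wordLift {R : Type*} [Semiring R] [Algebra ℚ R] (f : ℕ → R) : WordAlgebra →ₐ[ℚ] R :=
  MonoidAlgebra.lift ℚ R (FreeMonoid ℕ) (FreeMonoid.lift f)

theorem wordLift_letter {R : Type*} [Semiring R] [Algebra ℚ R] (f : ℕ → R) (hf : f 0 = 1) (n : ℕ) :
    wordLift f (letter n) = f n := by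
  unfold letter wordLift
  split_ifs with h
  · rw [h, map_one, hf]
  · rw [MonoidAlgebra.lift_of, FreeMonoid.lift_eval_of]

/-- The coproduct of the algebra of words. -/
def coprod : WordAlgebra →ₐ[ℚ] WordAlgebra ⊗[ℚ] WordAlgebra :=
  wordLift fun n => ∑ p ∈ antidiagonal n, letter p.1 ⊗ₜ[ℚ] letter p.2

theorem coprod_letter (n : ℕ) :
    coprod (letter n) = ∑ p ∈ antidiagonal n, letter p.1 ⊗ₜ[ℚ] letter p.2 :=
  wordLift_letter _ (by simp [letter_zero, Algebra.TensorProduct.one_def]) n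

/-- The generating function of the letters. -/
def letterSeries : PowerSeries WordAlgebra := PowerSeries.mk letter

/-- The inverse of the generating function of the letters. -/
def invSeries : PowerSeries WordAlgebra := PowerSeries.invOfUnit letterSeries 1

theorem constantCoeff_letterSeries :
    PowerSeries.constantCoeff letterSeries = ((1 : WordAlgebraˣ) : WordAlgebra) := by
  rw [← PowerSeries.coeff_zero_eq_constantCoeff_apply, letterSeries, PowerSeries.coeff_mk,
    letter_zero, Units.val_one]

theorem letterSeries_mul_invSeries : letterSeries * invSeries = 1 :=
  PowerSeries.mul_invOfUnit _ _ constantCoeff_letterSeries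

theorem invSeries_mul_letterSeries : invSeries * letterSeries = 1 :=
  PowerSeries.invOfUnit_mul _ _ constantCoeff_letterSeries

/-- The Euler operator on power series. -/
def euler {R : Type*} [Semiring R] (f : PowerSeries R) : PowerSeries R :=
  PowerSeries.mk fun n => (n : R) * PowerSeries.coeff n f

/-- The Leibniz rule survives noncommutative coefficients because natural numbers are central. -/
theorem euler_mul {R : Type*} [Semiring R] (f g : PowerSeries R) :
    euler (f * g) = euler f * g + f * euler g := by
  ext n
  simp only [euler, PowerSeries.coeff_mk, map_add, PowerSeries.coeff_mul, Finset.mul_sum,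
    ← Finset.sum_add_distrib]
  refine Finset.sum_congr rfl fun p hp => ?_
  rw [← mem_antidiagonal.1 hp, Nat.cast_add, add_mul, mul_assoc, ← mul_assoc _ (p.2 : R),
    ← (Nat.cast_commute p.2 _).eq, mul_assoc]

theorem map_euler {R S : Type*} [Semiring R] [Semiring S] (φ : R →+* S) (f : PowerSeries R) :
    PowerSeries.map φ (euler f) = euler (PowerSeries.map φ f) := by
  ext n
  simp [euler]

/-- The generating function of the power sums. -/
def powerSumSeries : PowerSeries WordAlgebra := euler letterSeries * invSeries

/-- The signed sum of the words of sum `n`. -/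
def signWord (n : ℕ) : WordAlgebra := PowerSeries.coeff n invSeries

/-- The power sum of degree `n`. -/
def powerSum (n : ℕ) : WordAlgebra := PowerSeries.coeff n powerSumSeries

theorem sum_letter_mul_signWord (n : ℕ) :
    ∑ p ∈ antidiagonal n, letter p.1 * signWord p.2 = if n = 0 then 1 else 0 := by
  have := congrArg (PowerSeries.coeff n) letterSeries_mul_invSeries
  rw [PowerSeries.coeff_mul, PowerSeries.coeff_one] at this
  simpa [letterSeries, signWord] using this

theorem powerSum_eq (n : ℕ) :
    powerSum n = ∑ p ∈ antidiagonal n, (p.1 : WordAlgebra) * letter p.1 * signWord p.2 := by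
  rw [powerSum, powerSumSeries, PowerSeries.coeff_mul]
  simp [letterSeries, signWord, euler]

/-- The first inclusion of the words into the tensor square. -/
abbrev inclL : WordAlgebra →+* WordAlgebra ⊗[ℚ] WordAlgebra :=
  (Algebra.TensorProduct.includeLeft :
    WordAlgebra →ₐ[ℚ] WordAlgebra ⊗[ℚ] WordAlgebra).toRingHom

/-- The second inclusion of the words into the tensor square. -/
abbrev inclR : WordAlgebra →+* WordAlgebra ⊗[ℚ] WordAlgebra :=
  (Algebra.TensorProduct.includeRight :
    WordAlgebra →ₐ[ℚ] WordAlgebra ⊗[ℚ] WordAlgebra).toRingHom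

theorem inclL_apply (u : WordAlgebra) : inclL u = u ⊗ₜ[ℚ] 1 := rfl

theorem inclR_apply (u : WordAlgebra) : inclR u = 1 ⊗ₜ[ℚ] u := rfl

/-- Words do not commute, but the two tensor factors do; this is the only commutation that the
primitivity of the power sums needs. -/
theorem commute_map_incl (f g : PowerSeries WordAlgebra) :
    Commute (PowerSeries.map inclL f) (PowerSeries.map inclR g) := by
  ext n
  rw [PowerSeries.coeff_mul, PowerSeries.coeff_mul, ← Finset.Nat.sum_antidiagonal_swap]
  refine Finset.sum_congr rfl fun p _ => ?_
  simp

/-- The series of letters is group-like; the convention that the letter `0` is `1` supplies the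
extreme terms of the coproduct. -/
theorem map_coprod_letterSeries :
    PowerSeries.map (coprod : WordAlgebra →+* _) letterSeries =
      PowerSeries.map inclL letterSeries * PowerSeries.map inclR letterSeries := by
  ext n
  rw [PowerSeries.coeff_mul]
  simp [letterSeries, coprod_letter]

/-- A logarithmic derivative turns the group-like product into a sum: the Leibniz rule applies, and
the commuting tensor factors let the second summand be moved past the first series. -/
theorem map_coprod_powerSumSeries :
    PowerSeries.map (coprod : WordAlgebra →+* _) powerSumSeries =
      PowerSeries.map inclL powerSumSeries + PowerSeries.map inclR powerSumSeries := by
  have hinv : ∀ {S : Type} [Ring S] (φ : WordAlgebra →+* S),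
      PowerSeries.map φ letterSeries * PowerSeries.map φ invSeries = 1 := fun φ => by
    rw [← map_mul, letterSeries_mul_invSeries, map_one]
  have hpsi : ∀ {S : Type} [Ring S] (φ : WordAlgebra →+* S),
      PowerSeries.map φ powerSumSeries * PowerSeries.map φ letterSeries =
        euler (PowerSeries.map φ letterSeries) := fun φ => by
    rw [← map_mul, ← map_euler, powerSumSeries, mul_assoc, invSeries_mul_letterSeries, mul_one]
  -- The identity is first multiplied on the right by the invertible series of letters, so that only
  -- `euler` of that series appears.
  have key : PowerSeries.map (coprod : WordAlgebra →+* _) powerSumSeries *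
        PowerSeries.map (coprod : WordAlgebra →+* _) letterSeries =
      (PowerSeries.map inclL powerSumSeries + PowerSeries.map inclR powerSumSeries) *
        PowerSeries.map (coprod : WordAlgebra →+* _) letterSeries := by
    rw [hpsi, map_coprod_letterSeries, euler_mul, add_mul, ← hpsi inclL, ← hpsi inclR,
      ← mul_assoc, ← mul_assoc, (commute_map_incl letterSeries powerSumSeries).eq, mul_assoc,
      mul_assoc]
  have := congrArg (· * PowerSeries.map (coprod : WordAlgebra →+* _) invSeries) key
  simpa only [mul_assoc, hinv, mul_one] using this

/-- The primitive elements of the algebra of words. -/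
def IsPrimitive (u : WordAlgebra) : Prop := coprod u = u ⊗ₜ[ℚ] 1 + 1 ⊗ₜ[ℚ] u

theorem isPrimitive_powerSum (n : ℕ) : IsPrimitive (powerSum n) := by
  have := congrArg (PowerSeries.coeff n) map_coprod_powerSumSeries
  simpa [IsPrimitive, powerSum, inclL_apply, inclR_apply] using this

/-- The mixed terms u ⊗ v and v ⊗ u occur in both products and cancel. -/
theorem IsPrimitive.commutator {u v : WordAlgebra} (hu : IsPrimitive u) (hv : IsPrimitive v) :
    IsPrimitive (u * v - v * u) := by
  unfold IsPrimitive at *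
  rw [map_sub, map_mul, map_mul, hu, hv]
  simp only [mul_add, add_mul, Algebra.TensorProduct.tmul_mul_tmul, mul_one, one_mul,
    TensorProduct.sub_tmul, TensorProduct.tmul_sub]
  abel


/-! ### The pairing of words with quasisymmetric functions -/

theorem exponentList_embDomain_succ (e : ℕ →₀ ℕ) :
    exponentList (e.embDomain (addRightEmbedding 1)) = exponentList e := by
  unfold exponentList
  rw [Finsupp.support_embDomain]
  have h : (e.support.map (addRightEmbedding 1)).sort = e.support.sort.map (addRightEmbedding 1) :=
    (Finset.map_sort (addRightEmbedding 1) e.support (· ≤ ·) (· ≤ ·) fun x _ y _ => by simp).symm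
  rw [h, List.map_map]
  exact List.map_congr_left fun x _ => Finsupp.embDomain_apply_self _ e x

/-- A word is read as an exponent vector, position by position, so zero letters are variables that
do not occur. -/
theorem exponentList_toFinsupp (w : List ℕ) :
    exponentList w.toFinsupp = w.filter (· ≠ 0) := by
  induction w with
  | nil => rw [List.toFinsupp_nil, exponentList_eq_nil.2 rfl, List.filter_nil]
  | cons x w ih =>
    rw [List.toFinsupp_cons_eq_single_add_embDomain]
    by_cases hx : x = 0
    · subst hx
      rw [Finsupp.single_zero, zero_add, exponentList_embDomain_succ, ih]
      simp
    · rw [List.filter_cons_of_pos (by simpa using hx), ← ih,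
        ← exponentList_embDomain_succ w.toFinsupp]
      set e := w.toFinsupp.embDomain (addRightEmbedding 1) with he
      have h0 : 0 ∉ e.support := by
        rw [he, Finsupp.support_embDomain]
        simp
      have hs : (Finsupp.single 0 x + e).support = insert 0 e.support := by
        ext i
        rcases Nat.eq_zero_or_pos i with rfl | hi
        · simp [hx]
        · simp [hi.ne']
      unfold exponentList
      rw [hs, Finset.sort_insert (· ≤ ·) (fun b _ => Nat.zero_le b) h0, List.map_cons]
      congr 1
      · have : e 0 = 0 := by simpa using h0
        simp [this]
      · refine List.map_congr_left fun i hi => ?_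
        have : i ≠ 0 := by
          rintro rfl
          exact h0 ((Finset.mem_sort _).1 hi)
        simp [this.symm]

/-- The functions on words that do not see the letter `0`. -/
def IsStable (c : List ℕ → ℚ) : Prop := ∀ u v, c (u ++ 0 :: v) = c (u ++ v)

theorem IsStable.cons {c : List ℕ → ℚ} (hc : IsStable c) (i : ℕ) :
    IsStable fun w => c (i :: w) := fun u v => hc (i :: u) v

/-- The coefficients of a power series as a function on words. -/
def wordCoeff (f : MvPowerSeries ℕ ℚ) (w : List ℕ) : ℚ := MvPowerSeries.coeff w.toFinsupp f

/-- Inserting a zero shifts the later variables and leaves the list of nonzero exponents alone,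
which is all that a quasisymmetric coefficient depends on. -/
theorem isStable_wordCoeff {f : MvPowerSeries ℕ ℚ} (hf : IsQuasisymmetric f) :
    IsStable (wordCoeff f) := fun u v =>
  hf.2 _ _ (by simp [exponentList_toFinsupp])

/-- The linear extension of a function on words. -/
def wordPairing (c : List ℕ → ℚ) : WordAlgebra →ₗ[ℚ] ℚ :=
  (Finsupp.linearCombination ℚ fun w : FreeMonoid ℕ => c w.toList) ∘ₗ
    (MonoidAlgebra.coeffLinearEquiv (S := ℚ) (M := FreeMonoid ℕ) ℚ).toLinearMap

theorem wordPairing_of (c : List ℕ → ℚ) (w : FreeMonoid ℕ) :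
    wordPairing c (MonoidAlgebra.of ℚ _ w) = c w.toList := by
  simp [wordPairing]

theorem word_induction {V : Type*} [AddCommMonoid V] [Module ℚ V] {f g : WordAlgebra →ₗ[ℚ] V}
    (h : ∀ w : FreeMonoid ℕ, f (MonoidAlgebra.of ℚ _ w) = g (MonoidAlgebra.of ℚ _ w)) : f = g :=
  MonoidAlgebra.lhom_ext' fun w => LinearMap.ext_ring (h w)

/-- Stability is what covers `i = 0`, where the letter is the unit of the algebra. -/
theorem wordPairing_letter_mul {c : List ℕ → ℚ} (hc : IsStable c) (i : ℕ) (u : WordAlgebra) :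
    wordPairing c (letter i * u) = wordPairing (fun w => c (i :: w)) u := by
  have : wordPairing c ∘ₗ LinearMap.mulLeft ℚ (letter i) = wordPairing fun w => c (i :: w) := by
    refine word_induction fun w => ?_
    rw [LinearMap.comp_apply, LinearMap.mulLeft_apply, wordPairing_of]
    unfold letter
    split_ifs with h
    · subst h
      rw [one_mul, wordPairing_of]
      exact (hc [] _).symm
    · rw [← map_mul, wordPairing_of]
      rfl
  exact LinearMap.congr_fun this u

/-- The linear extension to the tensor square of the product of two functions on words. -/
def wordPairing₂ (c c' : List ℕ → ℚ) : WordAlgebra ⊗[ℚ] WordAlgebra →ₗ[ℚ] ℚ :=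
  LinearMap.mul' ℚ ℚ ∘ₗ TensorProduct.map (wordPairing c) (wordPairing c')

theorem wordPairing₂_tmul (c c' : List ℕ → ℚ) (u v : WordAlgebra) :
    wordPairing₂ c c' (u ⊗ₜ v) = wordPairing c u * wordPairing c' v := rfl

theorem wordPairing₂_letter_mul {c c' : List ℕ → ℚ} (hc : IsStable c) (hc' : IsStable c')
    (i j : ℕ) (x : WordAlgebra ⊗[ℚ] WordAlgebra) :
    wordPairing₂ c c' (letter i ⊗ₜ letter j * x) =
      wordPairing₂ (fun w => c (i :: w)) (fun w => c' (j :: w)) x := by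
  induction x with
  | zero => simp
  | add x y hx hy => rw [mul_add, map_add, hx, hy, map_add]
  | tmul u v =>
    rw [Algebra.TensorProduct.tmul_mul_tmul, wordPairing₂_tmul, wordPairing₂_tmul,
      wordPairing_letter_mul hc, wordPairing_letter_mul hc']

/-- The part of a power series with exponent `i` at the first variable, as a power series in the
other variables. -/
def firstPart (i : ℕ) (f : MvPowerSeries ℕ ℚ) : MvPowerSeries ℕ ℚ := fun e =>
  MvPowerSeries.coeff (Finsupp.single 0 i + e.embDomain (addRightEmbedding 1)) f

theorem wordCoeff_cons (i : ℕ) (f : MvPowerSeries ℕ ℚ) (w : List ℕ) :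
    wordCoeff f (i :: w) = wordCoeff (firstPart i f) w := by
  unfold wordCoeff
  rw [List.toFinsupp_cons_eq_single_add_embDomain]
  rfl

theorem cons_apply_zero (i : ℕ) (e : ℕ →₀ ℕ) :
    (Finsupp.single 0 i + e.embDomain (addRightEmbedding 1) : ℕ →₀ ℕ) 0 = i := by
  rw [Finsupp.add_apply, Finsupp.single_eq_same,
    Finsupp.embDomain_of_notMem_range _ _ _ (by simp), add_zero]

theorem cons_apply_succ (i : ℕ) (e : ℕ →₀ ℕ) (n : ℕ) :
    (Finsupp.single 0 i + e.embDomain (addRightEmbedding 1) : ℕ →₀ ℕ) (n + 1) = e n := by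
  rw [Finsupp.add_apply, Finsupp.single_eq_of_ne (by simp), zero_add]
  exact Finsupp.embDomain_apply_self _ e n

/-- The Cauchy product in the first variable alone; its index set matches the coproduct of a letter,
which drives the duality below. -/
theorem firstPart_mul (i : ℕ) (f g : MvPowerSeries ℕ ℚ) :
    firstPart i (f * g) = ∑ p ∈ antidiagonal i, firstPart p.1 f * firstPart p.2 g := by
  ext e
  rw [map_sum]
  simp_rw [MvPowerSeries.coeff_mul]
  change MvPowerSeries.coeff (Finsupp.single 0 i + e.embDomain (addRightEmbedding 1)) (f * g) = _
  rw [MvPowerSeries.coeff_mul, ← Finset.sum_product']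
  have hinj : Function.Injective (fun n : ℕ => n + 1) := add_left_injective 1
  refine Finset.sum_nbij'
    (fun p => ((p.1 0, p.2 0), (p.1.comapDomain (· + 1) hinj.injOn,
      p.2.comapDomain (· + 1) hinj.injOn)))
    (fun q => (Finsupp.single 0 q.1.1 + q.2.1.embDomain (addRightEmbedding 1),
      Finsupp.single 0 q.1.2 + q.2.2.embDomain (addRightEmbedding 1))) ?_ ?_ ?_ ?_ ?_
  · intro p hp
    rw [HasAntidiagonal.mem_antidiagonal] at hp
    rw [mem_product, HasAntidiagonal.mem_antidiagonal, HasAntidiagonal.mem_antidiagonal]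
    constructor
    · dsimp only
      rw [← Finsupp.add_apply, hp, cons_apply_zero]
    · ext n
      rw [← cons_apply_succ i e n, ← hp]
      rfl
  · intro q hq
    rw [mem_product, HasAntidiagonal.mem_antidiagonal, HasAntidiagonal.mem_antidiagonal] at hq
    rw [HasAntidiagonal.mem_antidiagonal]
    ext n
    rw [Finsupp.add_apply]
    rcases n with _ | n
    · rw [cons_apply_zero, cons_apply_zero, cons_apply_zero, hq.1]
    · rw [cons_apply_succ, cons_apply_succ, cons_apply_succ, ← hq.2, Finsupp.add_apply]
  · intro p _
    refine Prod.ext ?_ ?_ <;>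
    · ext n
      rcases n with _ | n
      · rw [cons_apply_zero]
      · rw [cons_apply_succ]
        rfl
  · intro q _
    refine Prod.ext (Prod.ext ?_ ?_) (Prod.ext ?_ ?_)
    · exact cons_apply_zero _ _
    · exact cons_apply_zero _ _
    · ext n
      exact cons_apply_succ _ _ _
    · ext n
      exact cons_apply_succ _ _ _
  · intro p _
    change _ = MvPowerSeries.coeff _ f * MvPowerSeries.coeff _ g
    congr 2 <;>
    · congr 1
      ext n
      rcases n with _ | n
      · rw [cons_apply_zero]
      · rw [cons_apply_succ]
        rfl

/-- Multiplication of series and the coproduct obey the same recursion in the first letter. Only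
stability is assumed of the two series, since it passes to their first parts and keeps the induction
going. -/
theorem wordPairing₂_coprod_of (w : List ℕ) : ∀ (f g : MvPowerSeries ℕ ℚ),
    IsStable (wordCoeff f) → IsStable (wordCoeff g) →
      wordPairing₂ (wordCoeff f) (wordCoeff g) (coprod (MonoidAlgebra.of ℚ _ (FreeMonoid.ofList w))) =
        wordCoeff (f * g) w := by
  induction w with
  | nil =>
    intro f g _ _
    have h1 : (MonoidAlgebra.of ℚ (FreeMonoid ℕ) (FreeMonoid.ofList [])) = 1 := rfl
    have h2 : ∀ c, wordPairing c 1 = c [] := fun c => wordPairing_of c 1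
    rw [h1, map_one, Algebra.TensorProduct.one_def, wordPairing₂_tmul, h2, h2]
    simp [wordCoeff]
  | cons i w ih =>
    intro f g hf hg
    have h1 : (MonoidAlgebra.of ℚ (FreeMonoid ℕ) (FreeMonoid.ofList (i :: w))) =
      MonoidAlgebra.of ℚ _ (FreeMonoid.of i) * MonoidAlgebra.of ℚ _ (FreeMonoid.ofList w) := by
      rw [← map_mul]; rfl
    have h2 : coprod (MonoidAlgebra.of ℚ _ (FreeMonoid.of i)) =
        ∑ p ∈ antidiagonal i, letter p.1 ⊗ₜ[ℚ] letter p.2 := by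
      rw [coprod, wordLift, MonoidAlgebra.lift_of, FreeMonoid.lift_eval_of]
    rw [h1, map_mul, h2, Finset.sum_mul, map_sum, wordCoeff_cons, firstPart_mul]
    have h3 : wordCoeff (∑ p ∈ antidiagonal i, firstPart p.1 f * firstPart p.2 g) w =
        ∑ p ∈ antidiagonal i, wordCoeff (firstPart p.1 f * firstPart p.2 g) w := by
      unfold wordCoeff
      rw [map_sum]
    rw [h3]
    refine Finset.sum_congr rfl fun p _ => ?_
    rw [wordPairing₂_letter_mul hf hg]
    have hf' : (fun w => wordCoeff f (p.1 :: w)) = wordCoeff (firstPart p.1 f) :=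
      funext fun w => wordCoeff_cons _ _ w
    have hg' : (fun w => wordCoeff g (p.2 :: w)) = wordCoeff (firstPart p.2 g) :=
      funext fun w => wordCoeff_cons _ _ w
    rw [hf', hg']
    exact ih _ _ (hf' ▸ hf.cons _) (hg' ▸ hg.cons _)

/-- The pairing of words with quasisymmetric functions. -/
def pairing (u : WordAlgebra) : QSym →ₗ[ℚ] ℚ where
  toFun f := wordPairing (wordCoeff f.1) u
  map_add' f g := by
    have : wordPairing (wordCoeff (f + g : QSym).1) =
        wordPairing (wordCoeff f.1) + wordPairing (wordCoeff g.1) :=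
      word_induction fun w => by
        rw [LinearMap.add_apply, wordPairing_of, wordPairing_of, wordPairing_of]
        exact map_add (MvPowerSeries.coeff _) _ _
    rw [this, LinearMap.add_apply]
  map_smul' r f := by
    have : wordPairing (wordCoeff (r • f : QSym).1) = r • wordPairing (wordCoeff f.1) :=
      word_induction fun w => by
        rw [LinearMap.smul_apply, wordPairing_of, wordPairing_of]
        exact map_smul (MvPowerSeries.coeff _) _ _
    rw [this, LinearMap.smul_apply]
    rfl

theorem pairing_mul (u : WordAlgebra) (f g : QSym) :
    pairing u (f * g) = wordPairing₂ (wordCoeff f.1) (wordCoeff g.1) (coprod u) := by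
  have : wordPairing (wordCoeff (f * g : QSym).1) =
      wordPairing₂ (wordCoeff f.1) (wordCoeff g.1) ∘ₗ coprod.toLinearMap :=
    word_induction fun w => by
      rw [wordPairing_of]
      exact (wordPairing₂_coprod_of w.toList _ _ (isStable_wordCoeff f.2)
        (isStable_wordCoeff g.2)).symm
  exact LinearMap.congr_fun this u

/-- On a product f * g a primitive element takes the value ⟨u, f⟩⟨1, g⟩ + ⟨1, f⟩⟨u, g⟩, and pairing
with `1` is the constant term. -/
theorem pairing_eq_zero_of_mem {u : WordAlgebra} (hu : IsPrimitive u) {f : QSym}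
    (hf : f ∈ maximalIdeal ^ 2) : pairing u f = 0 := by
  have h1 : ∀ f ∈ maximalIdeal, wordPairing (wordCoeff f.1) 1 = 0 := fun f hf => by
    refine (wordPairing_of _ 1).trans ?_
    change MvPowerSeries.coeff (List.toFinsupp []) f.1 = 0
    rw [List.toFinsupp_nil]
    exact hf
  rw [pow_two] at hf
  induction hf using Submodule.mul_induction_on' with
  | mem_mul_mem f hf g hg =>
    rw [pairing_mul, hu, map_add, wordPairing₂_tmul, wordPairing₂_tmul, h1 f hf, h1 g hg]
    ring
  | add f _ g _ hf hg => rw [map_add, hf, hg, add_zero]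


/-! ### The matrices of words acting on the subsets of a poset -/

section Chains

open scoped Classical

variable {E : Type*} [Fintype E]

/-- The lower sets of a relation. -/
def IsLower (r : E → E → Prop) (I : Finset E) : Prop := ∀ x y, r x y → y ∈ I → x ∈ I

/-- The elements outside `I` with all predecessors in `I`. -/
def minimals (r : E → E → Prop) (I : Finset E) : Finset E :=
  univ.filter fun x => x ∉ I ∧ ∀ y, r y x → y ∈ I

theorem mem_minimals {r : E → E → Prop} {I : Finset E} {x : E} :
    x ∈ minimals r I ↔ x ∉ I ∧ ∀ y, r y x → y ∈ I := by simp [minimals]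

/-- The matrix of the pairs `I ⊆ J` such that `J \ I` consists of `n` minimal elements of the
complement of `I`. -/
def layer (r : E → E → Prop) (n : ℕ) : Matrix (Finset E) (Finset E) ℚ :=
  Matrix.of fun I J => if I ⊆ J ∧ J \ I ⊆ minimals r I ∧ #(J \ I) = n then 1 else 0

theorem layer_zero (r : E → E → Prop) : layer r 0 = 1 := by
  ext I J
  rw [layer, Matrix.of_apply, Matrix.one_apply]
  congr 1
  rw [eq_iff_iff]
  constructor
  · rintro ⟨h, -, h'⟩
    rw [Finset.card_eq_zero, Finset.sdiff_eq_empty_iff_subset] at h'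
    exact h.antisymm h'
  · rintro rfl
    simp

theorem sum_layer_mul (r : E → E → Prop) (n : ℕ) (I : Finset E) (g : Finset E → ℚ) :
    ∑ K, layer r n I K * g K = ∑ A ∈ powersetCard n (minimals r I), g (I ∪ A) := by
  simp only [layer, Matrix.of_apply, ite_mul, one_mul, zero_mul]
  rw [← Finset.sum_filter]
  have hd : ∀ A ∈ powersetCard n (minimals r I), (I ∪ A) \ I = A := fun A hA => by
    rw [Finset.union_sdiff_left, Finset.sdiff_eq_self_iff_disjoint, Finset.disjoint_left]
    exact fun x hx => (mem_minimals.1 ((mem_powersetCard.1 hA).1 hx)).1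
  refine Finset.sum_nbij' (fun K => K \ I) (fun A => I ∪ A) ?_ ?_ ?_ ?_ ?_
  · intro K hK
    exact mem_powersetCard.2 (mem_filter.1 hK).2.2
  · intro A hA
    refine mem_filter.2 ⟨mem_univ _, Finset.subset_union_left, ?_⟩
    rw [hd A hA]
    exact mem_powersetCard.1 hA
  · intro K hK
    exact Finset.union_sdiff_of_subset (mem_filter.1 hK).2.1
  · intro A hA
    exact hd A hA
  · intro K hK
    rw [Finset.union_sdiff_of_subset (mem_filter.1 hK).2.1]

/-- The representation of the algebra of words by matrices indexed by the subsets of a poset. -/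
def chainMatrix (r : E → E → Prop) : WordAlgebra →ₐ[ℚ] Matrix (Finset E) (Finset E) ℚ :=
  wordLift (layer r)

theorem chainMatrix_letter (r : E → E → Prop) (n : ℕ) :
    chainMatrix r (letter n) = layer r n :=
  wordLift_letter _ (layer_zero r) n

/-- The computation shared by `signWord` (weight 1) and `powerSum` (weight the first index): passing
through K = I ∪ A contributes the sign (-1)^(d - #A), so everything reduces to an alternating sum
over sets A of minimal elements inside `J`. -/
theorem sum_antidiagonal_sum_layer_mul (r : E → E → Prop) (J : Finset E) (d : ℕ) (w : ℕ → ℚ)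
    (I : Finset E) :
    ∑ p ∈ antidiagonal d, w p.1 * ∑ K, layer r p.1 I K *
        (if K ⊆ J ∧ #(J \ K) = p.2 then (-1) ^ p.2 else 0) =
      if I ⊆ J ∧ #(J \ I) = d then
        (-1) ^ d * ∑ A ∈ (minimals r I ∩ J).powerset, w #A * (-1) ^ #A else 0 := by
  have hterm : ∀ p ∈ antidiagonal d, w p.1 * ∑ K, layer r p.1 I K *
        (if K ⊆ J ∧ #(J \ K) = p.2 then (-1) ^ p.2 else 0) =
      ∑ A ∈ (minimals r I).powerset, if #A = p.1 then
        (w #A * if I ∪ A ⊆ J ∧ #(J \ (I ∪ A)) = p.2 then (-1) ^ p.2 else 0) else 0 := by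
    intro p _
    rw [sum_layer_mul, Finset.mul_sum, ← Finset.sum_filter, Finset.powersetCard_eq_filter]
    refine Finset.sum_congr rfl fun A hA => ?_
    rw [(mem_filter.1 hA).2]
  rw [Finset.sum_congr rfl hterm, Finset.sum_comm]
  have hcard : ∀ A ∈ (minimals r I).powerset, I ∪ A ⊆ J → #(J \ (I ∪ A)) + #A = #(J \ I) := by
    intro A hA h
    have hdisj : Disjoint A I := Finset.disjoint_left.2 fun x hx =>
      (mem_minimals.1 (mem_powerset.1 hA hx)).1
    have h1 : J \ (I ∪ A) = (J \ I) \ A := by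
      rw [Finset.sdiff_union_distrib, ← Finset.sdiff_sdiff_left']
    have h2 : A ⊆ J \ I := fun x hx => mem_sdiff.2
      ⟨h (mem_union_right _ hx), Finset.disjoint_left.1 hdisj hx⟩
    rw [h1, Finset.card_sdiff_add_card_eq_card h2]
  have hinner : ∀ A ∈ (minimals r I).powerset, (∑ p ∈ antidiagonal d, if #A = p.1 then
        (w #A * if I ∪ A ⊆ J ∧ #(J \ (I ∪ A)) = p.2 then (-1) ^ p.2 else 0) else 0) =
      if A ⊆ J then (if I ⊆ J ∧ #(J \ I) = d then (-1) ^ d * (w #A * (-1) ^ #A) else 0) else 0 := by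
    intro A hA
    have hc := hcard A hA
    -- For fixed A only the pair (#A, d - #A) of the antidiagonal contributes.
    by_cases hAd : #A ≤ d
    · rw [Finset.sum_eq_single (#A, d - #A)]
      · simp only [if_true]
        by_cases h1 : I ⊆ J
        · by_cases h2 : A ⊆ J
          · have h3 := hc (union_subset h1 h2)
            by_cases h4 : #(J \ I) = d
            · rw [if_pos ⟨union_subset h1 h2, by omega⟩, if_pos h2, if_pos ⟨h1, h4⟩]
              have : ((-1 : ℚ)) ^ d = (-1) ^ (d - #A) * (-1) ^ #A := by
                rw [← pow_add, Nat.sub_add_cancel hAd]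
              have h5 : ((-1 : ℚ)) ^ #A * (-1) ^ #A = 1 := by
                rw [← mul_pow]; simp
              rw [this]
              linear_combination (-(w #A) * (-1) ^ (d - #A)) * h5
            · rw [if_neg (fun h => h4 (by omega)), if_pos h2, if_neg (fun h => h4 h.2), mul_zero]
          · rw [if_neg (fun h => h2 (Finset.union_subset_right h.1)), if_neg h2, mul_zero]
        · rw [if_neg (fun h => h1 (Finset.union_subset_left h.1)), mul_zero]
          simp [h1]
      · rintro ⟨i, j⟩ hp hne
        rw [HasAntidiagonal.mem_antidiagonal] at hp
        refine if_neg fun h => hne ?_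
        dsimp only at h hp
        rw [h]
        congr
        omega
      · intro h
        exact absurd (HasAntidiagonal.mem_antidiagonal.2 (by dsimp only; omega)) h
    · rw [Finset.sum_eq_zero]
      · symm
        split_ifs with h1 h2
        · have := hc (union_subset h2.1 h1)
          omega
        · rfl
        · rfl
      · rintro ⟨i, j⟩ hp
        rw [HasAntidiagonal.mem_antidiagonal] at hp
        refine if_neg fun h => hAd ?_
        dsimp only at h hp
        omega
  rw [Finset.sum_congr rfl hinner, ← Finset.sum_filter]
  have hset : (minimals r I).powerset.filter (· ⊆ J) = (minimals r I ∩ J).powerset := by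
    ext A
    rw [mem_filter, mem_powerset, mem_powerset, Finset.subset_inter_iff]
  rw [hset]
  split_ifs
  · rw [Finset.mul_sum]
  · exact Finset.sum_const_zero

/-- A minimal element of J \ I has its predecessors in the lower set `J`, hence in `I`. -/
theorem exists_mem_minimals {r : E → E → Prop} (hr : WellFounded r) {I J : Finset E}
    (hJ : IsLower r J) (h : (J \ I).Nonempty) : (minimals r I ∩ J).Nonempty := by
  obtain ⟨x, hx, hmin⟩ := hr.has_min (↑(J \ I) : Set E) (coe_nonempty.2 h)
  have hx' := mem_sdiff.1 (mem_coe.1 hx)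
  refine ⟨x, mem_inter.2 ⟨mem_minimals.2 ⟨hx'.2, fun y hy => ?_⟩, hx'.1⟩⟩
  by_contra hyI
  exact hmin y (mem_coe.2 (mem_sdiff.2 ⟨hJ y x hy hx'.1, hyI⟩)) hy

/-- The claimed values satisfy the recursion that defines the inverse series: if J \ I is nonempty,
`J` contains a minimal element of the complement of `I`, and the alternating sum over subsets of a
nonempty set vanishes. -/
theorem chainMatrix_signWord {r : E → E → Prop} (hr : WellFounded r) {J : Finset E}
    (hJ : IsLower r J) (d : ℕ) (I : Finset E) :
    chainMatrix r (signWord d) I J = if I ⊆ J ∧ #(J \ I) = d then (-1) ^ d else 0 := by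
  induction d using Nat.strong_induction_on generalizing I with
  | _ d ih =>
    have h1 : ∑ p ∈ antidiagonal d, ∑ K, layer r p.1 I K * chainMatrix r (signWord p.2) K J =
        if d = 0 then (1 : Matrix (Finset E) (Finset E) ℚ) I J else 0 := by
      have := congrArg (fun u => chainMatrix r u I J) (sum_letter_mul_signWord d)
      simp only [map_sum, map_mul, chainMatrix_letter, Matrix.sum_apply, Matrix.mul_apply] at this
      rw [this]
      split_ifs <;> simp
    have h2 := sum_antidiagonal_sum_layer_mul r J d 1 I
    simp only [Pi.one_apply, one_mul] at h2
    have h3 : (if I ⊆ J ∧ #(J \ I) = d then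
        (-1) ^ d * ∑ A ∈ (minimals r I ∩ J).powerset, (-1 : ℚ) ^ #A else 0) =
        if d = 0 then (1 : Matrix (Finset E) (Finset E) ℚ) I J else 0 := by
      rcases Nat.eq_zero_or_pos d with rfl | hd
      · rw [if_pos rfl, Matrix.one_apply]
        have : (I ⊆ J ∧ #(J \ I) = 0) ↔ I = J := by
          rw [Finset.card_eq_zero, Finset.sdiff_eq_empty_iff_subset]
          exact ⟨fun h => h.1.antisymm h.2, fun h => ⟨h.subset, h.symm.subset⟩⟩
        rw [if_congr this rfl rfl]
        split_ifs with h
        · have : minimals r I ∩ J = ∅ := by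
            ext x
            simp only [mem_inter, mem_minimals, notMem_empty, iff_false, h]
            tauto
          simp [this]
        · rfl
      · rw [if_neg hd.ne']
        split_ifs with h
        · have hne := exists_mem_minimals hr hJ (Finset.card_pos.1 (h.2.symm ▸ hd))
          have := Finset.sum_powerset_neg_one_pow_card_of_nonempty hne
          have h' : ∑ A ∈ (minimals r I ∩ J).powerset, (-1 : ℚ) ^ #A = 0 := by
            exact_mod_cast congrArg (Int.cast : ℤ → ℚ) this
          rw [h', mul_zero]
        · rfl
    rw [h3, ← h1] at h2
    -- Both recursions agree in these terms by induction; what is left is the term of `layer r 0 =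
    -- 1`, which is the entry sought.
    have h4 : ∀ p ∈ antidiagonal d, p ≠ (0, d) →
        (∑ K, layer r p.1 I K * (if K ⊆ J ∧ #(J \ K) = p.2 then (-1) ^ p.2 else 0) -
        ∑ K, layer r p.1 I K * chainMatrix r (signWord p.2) K J) = 0 := by
      rintro ⟨i, j⟩ hp hne
      rw [HasAntidiagonal.mem_antidiagonal] at hp
      dsimp only at hp ⊢
      have : j < d := by
        rcases Nat.eq_zero_or_pos i with rfl | hi
        · exact absurd (by rw [← hp, zero_add]) hne
        · omega
      rw [sub_eq_zero]
      exact Finset.sum_congr rfl fun K _ => by rw [ih j this K]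
    rw [← sub_eq_zero, ← Finset.sum_sub_distrib, Finset.sum_eq_single (0, d) h4
      (fun h => absurd (by simp) h), layer_zero, sub_eq_zero] at h2
    simp only [Matrix.one_apply, ite_mul, one_mul, zero_mul, Finset.sum_ite_eq, mem_univ,
      if_true] at h2
    exact h2.symm

/-- Pairing A with `insert x A` leaves minus the alternating sum over the subsets of X \ {x}, which
is nonzero only if that set is empty. -/
theorem sum_powerset_card_mul_neg_one_pow {α : Type*} (X : Finset α) :
    ∑ A ∈ X.powerset, (#A : ℚ) * (-1) ^ #A = if #X = 1 then -1 else 0 := by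
  induction X using Finset.induction_on with
  | empty => simp
  | insert x X hx _ =>
    rw [Finset.sum_powerset_insert hx, ← Finset.sum_add_distrib]
    have h : ∀ A ∈ X.powerset, (#A : ℚ) * (-1) ^ #A + (#(insert x A) : ℚ) * (-1) ^ #(insert x A) =
        -(((-1 : ℤ) ^ #A : ℤ) : ℚ) := fun A hA => by
      rw [Finset.card_insert_of_notMem fun h => hx (mem_powerset.1 hA h)]
      push_cast
      ring
    rw [Finset.sum_congr rfl h, Finset.sum_neg_distrib, ← Int.cast_sum,
      Finset.sum_powerset_neg_one_pow_card, Finset.card_insert_of_notMem hx]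
    by_cases hX : X = ∅
    · simp [hX]
    · rw [if_neg hX, if_neg (by simpa using hX)]
      simp

/-- The Euler operator weights A by its size, and the weighted alternating sum detects exactly the
sets with one element. -/
theorem chainMatrix_powerSum {r : E → E → Prop} (hr : WellFounded r) {J : Finset E}
    (hJ : IsLower r J) (d : ℕ) (I : Finset E) :
    chainMatrix r (powerSum d) I J =
      if I ⊆ J ∧ #(J \ I) = d ∧ #(minimals r I ∩ J) = 1 then -(-1) ^ d else 0 := by
  rw [powerSum_eq]
  have h : ∀ p ∈ antidiagonal d,
      chainMatrix r ((p.1 : WordAlgebra) * letter p.1 * signWord p.2) I J =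
      (p.1 : ℚ) * ∑ K, layer r p.1 I K *
        (if K ⊆ J ∧ #(J \ K) = p.2 then (-1) ^ p.2 else 0) := fun p _ => by
    have h1 : ((p.1 : WordAlgebra) * letter p.1 * signWord p.2) =
        (p.1 : ℚ) • (letter p.1 * signWord p.2) := by
      rw [mul_assoc, Algebra.smul_def, map_natCast]
    rw [h1, map_smul, map_mul, Matrix.smul_apply, Matrix.mul_apply, chainMatrix_letter, smul_eq_mul]
    simp_rw [chainMatrix_signWord hr hJ]
  rw [map_sum, Matrix.sum_apply, Finset.sum_congr rfl h,
    sum_antidiagonal_sum_layer_mul r J d (fun n => (n : ℚ)) I,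
    sum_powerset_card_mul_neg_one_pow]
  by_cases h1 : I ⊆ J ∧ #(J \ I) = d
  · by_cases h2 : #(minimals r I ∩ J) = 1
    · rw [if_pos h1, if_pos h2, if_pos ⟨h1.1, h1.2, h2⟩]
      ring
    · rw [if_pos h1, if_neg h2, if_neg fun h => h2 h.2.2, mul_zero]
  · rw [if_neg h1, if_neg fun h => h1 ⟨h.1, h.2.1⟩]

end Chains

/-! ### Words and posets -/

section Link

open scoped Classical

variable {E : Type*} [Fintype E]

/-- The strictly increasing maps on the complement of `I` with prescribed numbers of elements in
their fibers. -/
def strictMaps (r : E → E → Prop) (I : Finset E) (w : List ℕ) : Set (E → ℕ) :=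
  {f | (∀ x ∈ I, f x = 0) ∧ (∀ x y, r x y → y ∉ I → x ∈ I ∨ f x < f y) ∧
    ∀ j, #(univ.filter fun x => x ∉ I ∧ f x = j) = w.getD j 0}

/-- Splitting off the smallest fiber of a strictly increasing map. -/
def strictMapsConsEquiv (r : E → E → Prop) (I : Finset E) (i : ℕ) (w : List ℕ) :
    strictMaps r I (i :: w) ≃
      Σ A : {A // A ∈ powersetCard i (minimals r I)}, strictMaps r (I ∪ A.1) w where
  toFun f := ⟨⟨univ.filter fun x => x ∉ I ∧ f.1 x = 0, by
      obtain ⟨f, h1, h2, h3⟩ := f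
      refine mem_powersetCard.2 ⟨fun x hx => ?_, by simpa using h3 0⟩
      have hx := (mem_filter.1 hx).2
      refine mem_minimals.2 ⟨hx.1, fun y hy => ?_⟩
      have := h2 y x hy hx.1
      have hx2 : f x = 0 := hx.2
      rw [hx2] at this
      simpa using this⟩, fun x => f.1 x - 1, by
      obtain ⟨f, h1, h2, h3⟩ := f
      refine ⟨fun x hx => ?_, fun x y hxy hy => ?_, fun j => ?_⟩
      · rcases mem_union.1 hx with hx | hx
        · simp [h1 x hx]
        · have := (mem_filter.1 hx).2.2
          dsimp only at this
          simp [this]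
      · simp only [mem_union, mem_filter, mem_univ, true_and, not_or, not_and] at hy ⊢
        have := h2 x y hxy hy.1
        have := hy.2 hy.1
        by_cases hx : x ∈ I <;> by_cases hx0 : f x = 0 <;> simp_all
        omega
      · have := h3 (j + 1)
        rw [List.getD_cons_succ] at this
        rw [← this]
        congr 1
        ext x
        simp only [mem_union, mem_filter, mem_univ, true_and, not_or, not_and]
        by_cases hx : x ∈ I
        · simp [hx]
        · simp only [hx, not_false_eq_true, true_and, forall_const]
          omega⟩
  invFun p := ⟨fun x => if x ∈ I ∪ p.1.1 then 0 else p.2.1 x + 1, by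
    obtain ⟨⟨A, hA⟩, f, h1, h2, h3⟩ := p
    rw [mem_powersetCard] at hA
    refine ⟨fun x hx => if_pos (mem_union_left _ hx), fun x y hxy hy => ?_, fun j => ?_⟩
    · by_cases hyA : y ∈ A
      · exact Or.inl ((mem_minimals.1 (hA.1 hyA)).2 x hxy)
      · have hy' : y ∉ I ∪ A := by simp [hy, hyA]
        have := h2 x y hxy hy'
        dsimp only
        rw [if_neg hy']
        by_cases hx : x ∈ I ∪ A
        · exact Or.inr (by simp [hx])
        · rw [if_neg hx]
          refine Or.inr ?_
          have := this.resolve_left hx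
          omega
    · dsimp only
      rcases j with _ | j
      · rw [List.getD_cons_zero]
        refine Eq.trans ?_ hA.2
        congr 1
        ext x
        have : x ∈ A → x ∉ I := fun hx => (mem_minimals.1 (hA.1 hx)).1
        by_cases hx : x ∈ I <;> by_cases hx' : x ∈ A <;> simp_all
      · rw [List.getD_cons_succ, ← h3 j]
        congr 1
        ext x
        by_cases hx : x ∈ I <;> by_cases hx' : x ∈ A <;> simp_all⟩
  left_inv := by
    rintro ⟨f, h1, h2, h3⟩
    ext x
    by_cases hx : x ∈ I
    · simp [hx, h1 x hx]
    · by_cases hx0 : f x = 0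
      · simp [hx0]
      · simp only [mem_union, mem_filter, mem_univ, true_and, hx, false_or, hx0]
        simp
        omega
  right_inv := by
    rintro ⟨⟨A, hA⟩, f, h1, h2, h3⟩
    have hset : (univ.filter fun x => x ∉ I ∧ (if x ∈ I ∪ A then 0 else f x + 1) = 0) = A := by
      ext x
      have : x ∈ A → x ∉ I := fun hx => (mem_minimals.1 ((mem_powersetCard.1 hA).1 hx)).1
      by_cases hx : x ∈ I <;> by_cases hx' : x ∈ A <;> simp_all
    refine Sigma.ext (Subtype.ext hset) ?_
    refine (Subtype.heq_iff_coe_eq fun g => ?_).2 ?_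
    · dsimp only
      rw [hset]
    · funext x
      by_cases hx : x ∈ I ∪ A
      · simp only [if_pos hx]
        exact (h1 x hx).symm
      · simp only [if_neg hx]
        rfl

/-- The transfer matrix argument: removing the fiber of the smallest value is one step from `I` to I
∪ A. Finiteness is proved alongside because the cardinality of the sigma type needs it. -/
theorem finite_and_card_strictMaps (r : E → E → Prop) (w : List ℕ) : ∀ I : Finset E,
    Finite (strictMaps r I w) ∧ (Nat.card (strictMaps r I w) : ℚ) =
      chainMatrix r (MonoidAlgebra.of ℚ _ (FreeMonoid.ofList w)) I univ := by
  induction w with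
  | nil =>
    intro I
    have h1 : (MonoidAlgebra.of ℚ (FreeMonoid ℕ) (FreeMonoid.ofList [])) = 1 := rfl
    rw [h1, map_one, Matrix.one_apply]
    by_cases hI : I = univ
    · have : strictMaps r I [] = {0} := by
        ext f
        simp only [strictMaps, hI, mem_univ, Set.mem_ofPred_eq, Set.mem_singleton_iff]
        constructor
        · exact fun h => funext fun x => h.1 x trivial
        · rintro rfl
          simp
      rw [if_pos hI, this]
      exact ⟨inferInstance, by simp⟩
    · have : strictMaps r I [] = ∅ := by
        refine Set.eq_empty_iff_forall_notMem.2 fun f hf => hI ?_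
        refine Finset.eq_univ_iff_forall.2 fun x => ?_
        by_contra hx
        have := hf.2.2 (f x)
        rw [List.getD_nil, Finset.card_eq_zero] at this
        exact Finset.eq_empty_iff_forall_notMem.1 this x (by simp [hx])
      rw [if_neg hI, this]
      exact ⟨inferInstance, by simp⟩
  | cons i w ih =>
    intro I
    have h1 : (MonoidAlgebra.of ℚ (FreeMonoid ℕ) (FreeMonoid.ofList (i :: w))) =
      MonoidAlgebra.of ℚ _ (FreeMonoid.of i) * MonoidAlgebra.of ℚ _ (FreeMonoid.ofList w) := by
      rw [← map_mul]; rfl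
    have h2 : chainMatrix r (MonoidAlgebra.of ℚ _ (FreeMonoid.of i)) = layer r i := by
      rw [chainMatrix, wordLift, MonoidAlgebra.lift_of, FreeMonoid.lift_eval_of]
    have hfin : ∀ A : {A // A ∈ powersetCard i (minimals r I)},
        Finite (strictMaps r (I ∪ A.1) w) := fun A => (ih _).1
    refine ⟨Finite.of_equiv _ (strictMapsConsEquiv r I i w).symm, ?_⟩
    rw [h1, map_mul, h2, Matrix.mul_apply, sum_layer_mul,
      Nat.card_congr (strictMapsConsEquiv r I i w), Nat.card_sigma, Nat.cast_sum]
    exact (Finset.sum_congr rfl fun A _ => (ih _).2).trans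
      (Finset.sum_coe_sort (powersetCard i (minimals r I)) fun A =>
        chainMatrix r (MonoidAlgebra.of ℚ _ (FreeMonoid.ofList w)) (I ∪ A) univ)

theorem IsStable.filter {c : List ℕ → ℚ} (w : List ℕ) (hc : IsStable c) :
    c (w.filter (· ≠ 0)) = c w := by
  induction w generalizing c with
  | nil => rfl
  | cons i w ih =>
    by_cases hi : i = 0
    · subst hi
      rw [List.filter_cons_of_neg (by simp), ih hc]
      exact (hc [] w).symm
    · rw [List.filter_cons_of_pos (by simpa using hi)]
      exact ih (hc.cons i)

/-- The boundary `0` is counted too, so blocks are numbered from one. -/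
theorem blockOf_boundaries {n : ℕ} (β : Composition n) (i : Fin n) :
    blockOf β.boundaries i = β.index i + 1 := by
  unfold blockOf
  have : β.boundaries.filter (· ≤ i.castSucc) =
      (univ.filter fun k : Fin (β.length + 1) => (k : ℕ) ≤ β.index i).map
        β.boundary.toEmbedding := by
    unfold Composition.boundaries
    rw [Finset.filter_map]
    congr 1
    ext k
    simp only [mem_filter, mem_univ, true_and, Function.comp_apply]
    have hk : (β.boundary.toEmbedding k ≤ i.castSucc) ↔ β.sizeUpTo k ≤ i := Iff.rfl
    rw [hk]
    constructor
    · intro h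
      by_contra hlt
      have h1 := β.lt_sizeUpTo_index_succ i
      have h2 := β.monotone_sizeUpTo (show (β.index i).succ.val ≤ k by simp; omega)
      omega
    · intro h
      exact (β.monotone_sizeUpTo h).trans (β.sizeUpTo_index_le i)
  rw [this, Finset.card_map]
  have h2 : (univ.filter fun k : Fin (β.length + 1) => (k : ℕ) ≤ β.index i) =
      Finset.Iic (β.index i).castSucc := by
    ext k
    simp [Fin.le_def]
  rw [h2, Fin.card_Iic]
  simp

theorem card_blockOf_eq {n : ℕ} (β : Composition n) (j : ℕ) :
    #(univ.filter fun i : Fin n => blockOf β.boundaries i = j + 1) = β.blocks.getD j 0 := by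
  simp only [blockOf_boundaries, Nat.add_right_cancel_iff]
  by_cases hj : j < β.length
  · rw [List.getD_eq_getElem _ _ hj]
    have : (univ.filter fun i : Fin n => (β.index i : ℕ) = j) =
        univ.map (β.embedding ⟨j, hj⟩).toEmbedding := by
      ext i
      have := β.mem_range_embedding_iff' (j := i) (i := ⟨j, hj⟩)
      simp only [Set.mem_range] at this
      simp only [mem_filter, mem_univ, true_and, mem_map]
      rw [Fin.ext_iff] at this
      exact ⟨fun h => this.2 h.symm, fun h => (this.1 h).symm⟩
    rw [this, Finset.card_map, Finset.card_univ, Fintype.card_fin]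
    rfl
  · rw [List.getD_eq_default _ _ (not_lt.1 hj), Finset.card_eq_zero]
    ext i
    simp only [mem_filter, mem_univ, true_and, notMem_empty, iff_false]
    have := (β.index i).2
    omega

theorem exists_equiv_of_card_fiber {α β γ : Type*} [Fintype α] [Fintype β] [DecidableEq γ]
    (f : α → γ) (g : β → γ)
    (h : ∀ c, #(univ.filter fun a => f a = c) = #(univ.filter fun b => g b = c)) :
    ∃ e : α ≃ β, ∀ a, g (e a) = f a := by
  have h' : ∀ c, Nonempty ({a // f a = c} ≃ {b // g b = c}) := fun c => by
    rw [← Fintype.card_eq, Fintype.card_subtype, Fintype.card_subtype, h]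
  refine ⟨(Equiv.sigmaFiberEquiv f).symm.trans ((Equiv.sigmaCongrRight fun c =>
    Classical.choice (h' c)).trans (Equiv.sigmaFiberEquiv g)), fun a => ?_⟩
  exact ((Classical.choice (h' (f a))) ⟨a, rfl⟩).2

/-- By `goodSet_image`, the linear extensions contributing to a monomial correspond to strictly
increasing maps with the prescribed fibers. Both sides ignore zero letters, so the word may be taken
to be a composition. -/
theorem wordCoeff_posetQSym (P : PartialOrder E) {γ : E → ℕ} (hγ : IsStrictLabeling P γ)
    (w : List ℕ) :
    wordCoeff (posetQSym P γ).1 w =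
      chainMatrix P.lt (MonoidAlgebra.of ℚ _ (FreeMonoid.ofList w)) ∅ univ := by
  have hstab : IsStable fun w => chainMatrix P.lt
      (MonoidAlgebra.of ℚ _ (FreeMonoid.ofList w)) ∅ univ := fun u v => by
    have h0 : chainMatrix P.lt (MonoidAlgebra.of ℚ _ (FreeMonoid.of 0)) = 1 := by
      rw [chainMatrix, wordLift, MonoidAlgebra.lift_of, FreeMonoid.lift_eval_of, layer_zero]
    have h1 : FreeMonoid.ofList (u ++ 0 :: v) =
      FreeMonoid.ofList u * (FreeMonoid.of 0 * FreeMonoid.ofList v) := rfl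
    dsimp only
    rw [h1, FreeMonoid.ofList_append, map_mul, map_mul, map_mul, map_mul, h0, one_mul, ← map_mul,
      ← map_mul]
  rw [← (isStable_wordCoeff (posetQSym P γ).2).filter w, ← hstab.filter w]
  have hpos : ∀ i ∈ w.filter (· ≠ 0), 0 < i := fun i hi => by
    have := (List.mem_filter.1 hi).2
    simp at this
    omega
  generalize w.filter (· ≠ 0) = w at hpos
  rw [← (finite_and_card_strictMaps P.lt w ∅).2]
  have hsum : ∀ β : Composition (Nat.card E), wordCoeff (monomialQSym β).1 w =
      if w = β.blocks then 1 else 0 := fun β => by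
    change (if exponentList w.toFinsupp = β.blocks then (1 : ℚ) else 0) = _
    rw [exponentList_toFinsupp, List.filter_eq_self.2 fun i hi => by
      simpa using (hpos i hi).ne']
  have hcoeff : wordCoeff (posetQSym P γ).1 w = ∑ β : Composition (Nat.card E),
      ((goodSet P γ β.boundaries).ncard : ℚ) * if w = β.blocks then 1 else 0 := by
    unfold posetQSym
    rw [posetQSymAux_eq _ P γ hγ.1]
    simp_rw [← hsum]
    unfold wordCoeff
    rw [AddSubmonoidClass.coe_finsetSum, map_sum]
    refine Finset.sum_congr rfl fun β _ => ?_
    rw [← nsmul_eq_mul, ← map_nsmul]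
    rfl
  rw [hcoeff]
  by_cases hn : w.sum = Nat.card E
  · let β : Composition (Nat.card E) := ⟨w, fun {i} hi => hpos i hi, hn⟩
    rw [Finset.sum_eq_single β]
    · rw [if_pos rfl, mul_one, Nat.cast_inj, ← (goodSet_injOn P γ β.boundaries).ncard_image,
        goodSet_image P γ hγ]
      rw [← Nat.card_coe_set_eq]
      -- The two kinds of maps differ by a shift: fibers are indexed from zero, blocks from one.
      refine (Nat.card_congr (Equiv.ofBijective (fun f : strictMaps P.lt ∅ w =>
        (⟨fun x => f.1 x + 1, ?_⟩ : {f : E → ℕ | (∀ x y, P.lt x y → f x < f y) ∧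
          ∃ τ : Fin (Nat.card E) ≃ E, ∀ i, f (τ i) = blockOf β.boundaries i})) ⟨?_, ?_⟩)).symm
      · obtain ⟨f, -, h2, h3⟩ := f
        refine ⟨fun x y hxy => by simpa using h2 x y hxy (notMem_empty y), ?_⟩
        refine exists_equiv_of_card_fiber (blockOf β.boundaries) (fun x => f x + 1) fun c => ?_
        rcases c with _ | c
        · simp [blockOf_boundaries]
        · have h5 : _ = w.getD c 0 := card_blockOf_eq β c
          rw [← h3 c] at h5
          convert h5 using 2
          ext x
          simp
      · rintro ⟨f, hf⟩ ⟨g, hg⟩ h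
        ext x
        have := congrFun (Subtype.ext_iff.1 h) x
        simpa using this
      · rintro ⟨f, h1, τ, h2⟩
        have hf : ∀ x, 0 < f x := fun x => by
          have := h2 (τ.symm x)
          rw [τ.apply_symm_apply, blockOf_boundaries] at this
          omega
        refine ⟨⟨fun x => f x - 1, by simp, fun x y hxy _ => Or.inr ?_, fun j => ?_⟩, ?_⟩
        · have := h1 x y hxy
          have := hf x
          dsimp only
          omega
        · rw [show w.getD j 0 = β.blocks.getD j 0 from rfl, ← card_blockOf_eq]
          refine (Finset.card_equiv τ fun i => ?_).symm
          have := hf (τ i)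
          have h3 := h2 i
          simp only [mem_filter, mem_univ, true_and, notMem_empty, not_false_eq_true]
          omega
        · ext x
          have := hf x
          dsimp only
          omega
    · intro β' _ hne
      rw [if_neg fun h => hne (Composition.ext h.symm), mul_zero]
    · exact fun h => absurd (mem_univ _) h
  · have hzero : ∀ β ∈ (univ : Finset (Composition (Nat.card E))),
        ((goodSet P γ β.boundaries).ncard : ℚ) * (if w = β.blocks then 1 else 0) = 0 :=
      fun β _ => by rw [if_neg fun h => hn (by rw [h, β.blocks_sum]), mul_zero]
    rw [Finset.sum_eq_zero hzero]
    have : IsEmpty (strictMaps P.lt ∅ w) := ⟨fun ⟨f, _, _, h3⟩ => hn ?_⟩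
    · simp
    · have h4 : ∀ x, f x < w.length := fun x => by
        by_contra hx
        have := h3 (f x)
        rw [List.getD_eq_default _ _ (not_lt.1 hx), Finset.card_eq_zero] at this
        exact Finset.eq_empty_iff_forall_notMem.1 this x (by simp)
      have h5 : Set.MapsTo f ↑(univ : Finset E) ↑(range w.length) := fun x _ => by
        simpa using h4 x
      rw [Nat.card_eq_fintype_card, ← Finset.card_univ,
        Finset.card_eq_sum_card_fiberwise h5, Finset.sum_range, ← Fin.sum_univ_getElem]
      refine Finset.sum_congr rfl fun j _ => ?_
      have := h3 j
      rw [List.getD_eq_getElem _ _ j.2] at this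
      rw [← Fin.getElem_fin] at this
      simpa using this.symm

theorem pairing_posetQSym (P : PartialOrder E) {γ : E → ℕ} (hγ : IsStrictLabeling P γ)
    (u : WordAlgebra) : pairing u (posetQSym P γ) = chainMatrix P.lt u ∅ univ := by
  have : wordPairing (wordCoeff (posetQSym P γ).1) =
      Matrix.entryLinearMap ℚ ℚ ∅ univ ∘ₗ (chainMatrix P.lt).toLinearMap :=
    word_induction fun w => by
      rw [wordPairing_of, wordCoeff_posetQSym P hγ]
      rfl
  exact LinearMap.congr_fun this u

end Link

/-! ### Exchange relations of rank two -/

section RankTwo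

open scoped Classical

variable {E : Type*} [Fintype E]

theorem isLower_empty {E : Type*} (r : E → E → Prop) : IsLower r ∅ :=
  fun _ _ _ h => absurd h (notMem_empty _)

theorem isLower_univ (r : E → E → Prop) : IsLower r univ := fun _ _ _ _ => mem_univ _

theorem IsLower.union {r : E → E → Prop} {I A : Finset E} (hI : IsLower r I)
    (hA : A ⊆ minimals r I) : IsLower r (I ∪ A) := fun x y hxy hy => by
  rcases mem_union.1 hy with hy | hy
  · exact mem_union_left _ (hI x y hxy hy)
  · exact mem_union_left _ ((mem_minimals.1 (hA hy)).2 x hxy)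

/-- Every step of a transfer matrix leads from a lower set to a lower set. In a product of matrices
this discards the intermediate sets for which the closed formulas are not available. -/
theorem chainMatrix_eq_zero {r : E → E → Prop} {I J : Finset E} (hI : IsLower r I)
    (hJ : ¬ IsLower r J) (u : WordAlgebra) : chainMatrix r u I J = 0 := by
  have hw : ∀ (w : List ℕ) (I : Finset E), IsLower r I →
      chainMatrix r (MonoidAlgebra.of ℚ _ (FreeMonoid.ofList w)) I J = 0 := by
    intro w
    induction w with
    | nil =>
      intro I hI
      have h1 : (MonoidAlgebra.of ℚ (FreeMonoid ℕ) (FreeMonoid.ofList [])) = 1 := rfl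
      rw [h1, map_one, Matrix.one_apply, if_neg]
      rintro rfl
      exact hJ hI
    | cons i w ih =>
      intro I hI
      have h1 : (MonoidAlgebra.of ℚ (FreeMonoid ℕ) (FreeMonoid.ofList (i :: w))) =
        MonoidAlgebra.of ℚ _ (FreeMonoid.of i) * MonoidAlgebra.of ℚ _ (FreeMonoid.ofList w) := by
        rw [← map_mul]; rfl
      have h2 : chainMatrix r (MonoidAlgebra.of ℚ _ (FreeMonoid.of i)) = layer r i := by
        rw [chainMatrix, wordLift, MonoidAlgebra.lift_of, FreeMonoid.lift_eval_of]
      rw [h1, map_mul, h2, Matrix.mul_apply, sum_layer_mul]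
      exact Finset.sum_eq_zero fun A hA => ih _ (hI.union (mem_powersetCard.1 hA).1)
  have : Matrix.entryLinearMap ℚ ℚ I J ∘ₗ (chainMatrix r).toLinearMap = 0 :=
    word_induction fun w => hw w.toList I hI
  exact LinearMap.congr_fun this u

/-- The lower sets with `a` elements and a unique minimal element. -/
def pointedLower (r : E → E → Prop) (a : ℕ) : Finset (Finset E) :=
  univ.filter fun K => IsLower r K ∧ #K = a ∧ #(minimals r ∅ ∩ K) = 1

theorem chainMatrix_powerSum_mul_signWord {r : E → E → Prop} (hr : WellFounded r) {a c : ℕ}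
    (hac : a + c = Fintype.card E) :
    chainMatrix r (powerSum a * signWord c) ∅ univ =
      -(-1) ^ Fintype.card E * #(pointedLower r a) := by
  rw [map_mul, Matrix.mul_apply, pointedLower, Finset.card_eq_sum_ones, Nat.cast_sum,
    Finset.sum_filter, Finset.mul_sum]
  refine Finset.sum_congr rfl fun K _ => ?_
  by_cases hK : IsLower r K
  · rw [chainMatrix_powerSum hr hK, chainMatrix_signWord hr (isLower_univ r), sdiff_empty]
    by_cases h : #K = a ∧ #(minimals r ∅ ∩ K) = 1
    · have : #(univ \ K) = c := by
        rw [Finset.card_univ_sdiff]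
        omega
      rw [if_pos ⟨empty_subset _, h⟩, if_pos ⟨subset_univ _, this⟩, if_pos ⟨hK, h⟩, ← hac, pow_add]
      simp
    · have h1 : ¬(∅ ⊆ K ∧ #K = a ∧ #(minimals r ∅ ∩ K) = 1) := fun h' => h h'.2
      have h2 : ¬(IsLower r K ∧ #K = a ∧ #(minimals r ∅ ∩ K) = 1) := fun h' => h h'.2
      rw [if_neg h1, if_neg h2, zero_mul, mul_zero]
  · rw [chainMatrix_eq_zero (isLower_empty r) hK, if_neg fun h => hK h.1, zero_mul, mul_zero]

/-- The second factor adds the condition that the complement of the pointed lower set also has a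
single minimal element. -/
theorem chainMatrix_powerSum_mul_powerSum {r : E → E → Prop} (hr : WellFounded r) (a c : ℕ) :
    chainMatrix r (powerSum a * powerSum c) ∅ univ =
      if a + c = Fintype.card E then
        (-1 : ℚ) ^ Fintype.card E *
          #((pointedLower r a).filter fun K => #(minimals r K) = 1) else 0 := by
  rw [map_mul, Matrix.mul_apply]
  have hterm : ∀ K, chainMatrix r (powerSum a) ∅ K * chainMatrix r (powerSum c) K univ =
      ((if a + c = Fintype.card E then (if IsLower r K ∧ #K = a ∧ #(minimals r ∅ ∩ K) = 1 then
        (if #(minimals r K) = 1 then (-1) ^ Fintype.card E else 0) else 0) else 0 : ℚ)) := by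
    intro K
    by_cases hK : IsLower r K
    · rw [chainMatrix_powerSum hr hK, chainMatrix_powerSum hr (isLower_univ r), sdiff_empty,
        inter_univ]
      by_cases h : #K = a ∧ #(minimals r ∅ ∩ K) = 1
      · have h3 : ∅ ⊆ K ∧ #K = a ∧ #(minimals r ∅ ∩ K) = 1 := ⟨empty_subset _, h⟩
        have h4 : IsLower r K ∧ #K = a ∧ #(minimals r ∅ ∩ K) = 1 := ⟨hK, h⟩
        have hc : #(univ \ K) = c ↔ a + c = Fintype.card E := by
          have := Finset.card_le_univ K
          rw [Finset.card_univ_sdiff]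
          omega
        rw [if_pos h3, if_pos h4]
        by_cases h1 : a + c = Fintype.card E
        · by_cases h2 : #(minimals r K) = 1
          · have h5 : K ⊆ univ ∧ #(univ \ K) = c ∧ #(minimals r K) = 1 :=
              ⟨subset_univ _, hc.2 h1, h2⟩
            rw [if_pos h5, if_pos h1, if_pos h2, ← h1, pow_add]
            ring
          · have h5 : ¬(K ⊆ univ ∧ #(univ \ K) = c ∧ #(minimals r K) = 1) :=
              fun h' => h2 h'.2.2
            rw [if_neg h5, if_pos h1, if_neg h2, mul_zero]
        · have h5 : ¬(K ⊆ univ ∧ #(univ \ K) = c ∧ #(minimals r K) = 1) :=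
            fun h' => h1 (hc.1 h'.2.1)
          rw [if_neg h5, if_neg h1, mul_zero]
      · have h1 : ¬(∅ ⊆ K ∧ #K = a ∧ #(minimals r ∅ ∩ K) = 1) := fun h' => h h'.2
        have h2 : ¬(IsLower r K ∧ #K = a ∧ #(minimals r ∅ ∩ K) = 1) := fun h' => h h'.2
        rw [if_neg h1, if_neg h2, zero_mul, ite_self]
    · have h2 : ¬(IsLower r K ∧ #K = a ∧ #(minimals r ∅ ∩ K) = 1) := fun h' => hK h'.1
      rw [chainMatrix_eq_zero (isLower_empty r) hK, if_neg h2, zero_mul, ite_self]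
  rw [Finset.sum_congr rfl fun K _ => hterm K]
  split_ifs with h
  · rw [← Finset.sum_filter, ← Finset.sum_filter, Finset.sum_const, nsmul_eq_mul, mul_comm]
    rfl
  · exact Finset.sum_const_zero

/-- The relation of being a base of a matroid of rank two on the pairs of elements. -/
structure IsExchange {E : Type*} (b : E → E → Prop) : Prop where
  symm : ∀ x y, b x y → b y x
  irrefl : ∀ x, ¬ b x x
  exchange : ∀ x y z w, b x z → b y w → b x y ∨ b y z

/-- The elements that lie in a base. -/
def nonloops (b : E → E → Prop) : Finset E := univ.filter fun x => ∃ y, b x y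

/-- The parallel class of `x`. -/
def parallelClass (b : E → E → Prop) (x : E) : Finset E := (nonloops b).filter fun y => ¬ b x y

/-- The strict order of the base `{x, y}`. -/
def pairLT {E : Type*} (b : E → E → Prop) (x y p q : E) : Prop :=
  q ≠ x ∧ q ≠ y ∧ ((p = x ∧ b q y) ∨ (p = y ∧ b x q))

variable {b : E → E → Prop}

theorem mem_nonloops {x : E} : x ∈ nonloops b ↔ ∃ y, b x y := by simp [nonloops]

theorem mem_parallelClass {x y : E} : y ∈ parallelClass b x ↔ (∃ z, b y z) ∧ ¬ b x y := by
  simp [parallelClass, nonloops]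

theorem IsExchange.pairLT_comm {E : Type*} {b : E → E → Prop} (hb : IsExchange b) (x y : E) :
    pairLT b x y = pairLT b y x := by
  funext p q
  have h1 : b q y ↔ b y q := ⟨hb.symm _ _, hb.symm _ _⟩
  have h2 : b q x ↔ b x q := ⟨hb.symm _ _, hb.symm _ _⟩
  simp only [pairLT, eq_iff_iff, h1, h2]
  tauto

theorem wellFounded_pairLT {E : Type*} (b : E → E → Prop) (x y : E) : WellFounded (pairLT b x y) := by
  refine ⟨fun q => ⟨q, fun p hp => ⟨p, fun p' hp' => ?_⟩⟩⟩
  rcases hp.2.2 with h | h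
  · exact absurd h.1 hp'.1
  · exact absurd h.1 hp'.2.1

/-- A nonloop outside the base can replace `x` or `y` by the exchange property, so it lies above one
of them; a loop is related to nothing. -/
theorem IsExchange.mem_minimals_empty (hb : IsExchange b) {x y : E} (hxy : b x y) {q : E} :
    q ∈ minimals (pairLT b x y) ∅ ↔ q = x ∨ q = y ∨ q ∉ nonloops b := by
  rw [mem_minimals, mem_nonloops]
  constructor
  · rintro ⟨-, h⟩
    by_contra! hq
    obtain ⟨h1, h2, w, hw⟩ := hq
    rcases hb.exchange x q y w hxy hw with h3 | h3
    · exact notMem_empty _ (h y ⟨h1, h2, Or.inr ⟨rfl, h3⟩⟩)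
    · exact notMem_empty _ (h x ⟨h1, h2, Or.inl ⟨rfl, h3⟩⟩)
  · refine fun h => ⟨notMem_empty _, fun p hp => ?_⟩
    obtain ⟨h1, h2, h3⟩ := hp
    refine absurd ?_ ((h.resolve_left h1).resolve_left h2)
    rcases h3 with h3 | h3
    · exact ⟨y, h3.2⟩
    · exact ⟨x, hb.symm _ _ h3.2⟩

theorem IsExchange.self_mem_parallelClass (hb : IsExchange b) {x : E} (hx : x ∈ nonloops b) :
    x ∈ parallelClass b x := mem_parallelClass.2 ⟨mem_nonloops.1 hx, hb.irrefl x⟩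

/-- A nonloop outside the base lies above `y` exactly if it is not parallel to `x`. A lower set
avoiding `y` and the loops therefore stays in the class of `x`, whose other elements lie above `x`
only. -/
theorem IsExchange.lower_iff_left (hb : IsExchange b) {x y : E} (hxy : b x y) (K : Finset E) :
    IsLower (pairLT b x y) K ∧ minimals (pairLT b x y) ∅ ∩ K = {x} ↔
      x ∈ K ∧ K ⊆ parallelClass b x := by
  have hne : x ≠ y := by
    rintro rfl
    exact hb.irrefl _ hxy
  constructor
  · rintro ⟨h1, h2⟩
    have hx : x ∈ minimals (pairLT b x y) ∅ ∩ K := by rw [h2]; exact mem_singleton_self x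
    have hmin : ∀ q ∈ K, (q = x ∨ q = y ∨ q ∉ nonloops b) → q = x := fun q hq h => by
      rw [← mem_singleton, ← h2]
      exact mem_inter.2 ⟨(hb.mem_minimals_empty hxy).2 h, hq⟩
    refine ⟨(mem_inter.1 hx).2, fun q hq => ?_⟩
    by_cases hqx : q = x
    · rw [hqx]
      exact hb.self_mem_parallelClass (mem_nonloops.2 ⟨y, hxy⟩)
    · refine mem_parallelClass.2 ⟨?_, fun hbq => ?_⟩
      · by_contra h
        exact hqx (hmin q hq (Or.inr (Or.inr fun h' => h (mem_nonloops.1 h'))))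
      · have hqy : q ≠ y := fun h => hqx (hmin q hq (Or.inr (Or.inl h)))
        have := h1 y q ⟨hqx, hqy, Or.inr ⟨rfl, hbq⟩⟩ hq
        exact hne (hmin y this (Or.inr (Or.inl rfl))).symm
  · rintro ⟨hx, hK⟩
    refine ⟨fun p q hpq hq => ?_, ?_⟩
    · rcases hpq.2.2 with h | h
      · rw [h.1]
        exact hx
      · exact absurd h.2 (mem_parallelClass.1 (hK hq)).2
    · ext q
      rw [mem_inter, hb.mem_minimals_empty hxy, mem_singleton]
      constructor
      · rintro ⟨h | h | h, hq⟩
        · exact h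
        · rw [h] at hq
          exact absurd hxy (mem_parallelClass.1 (hK hq)).2
        · exact absurd (mem_nonloops.2 (mem_parallelClass.1 (hK hq)).1) h
      · rintro rfl
        exact ⟨Or.inl rfl, hx⟩

/-- Any nonloop in a lower set brings `x` or `y` with it as a second minimal element. -/
theorem IsExchange.lower_iff_loop (hb : IsExchange b) {x y : E} (hxy : b x y) {m : E}
    (hm : m ∉ nonloops b) (K : Finset E) :
    IsLower (pairLT b x y) K ∧ minimals (pairLT b x y) ∅ ∩ K = {m} ↔ K = {m} := by
  have hx : x ∈ nonloops b := mem_nonloops.2 ⟨y, hxy⟩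
  have hy : y ∈ nonloops b := mem_nonloops.2 ⟨x, hb.symm _ _ hxy⟩
  constructor
  · rintro ⟨h1, h2⟩
    have hmK : m ∈ minimals (pairLT b x y) ∅ ∩ K := by rw [h2]; exact mem_singleton_self m
    have hmin : ∀ q ∈ K, (q = x ∨ q = y ∨ q ∉ nonloops b) → q = m := fun q hq h => by
      rw [← mem_singleton, ← h2]
      exact mem_inter.2 ⟨(hb.mem_minimals_empty hxy).2 h, hq⟩
    have hxK : x ∉ K := fun h => hm (hmin x h (Or.inl rfl) ▸ hx)
    have hyK : y ∉ K := fun h => hm (hmin y h (Or.inr (Or.inl rfl)) ▸ hy)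
    refine Finset.eq_singleton_iff_unique_mem.2 ⟨(mem_inter.1 hmK).2, fun q hq => ?_⟩
    refine hmin q hq (Or.inr (Or.inr fun h => ?_))
    obtain ⟨w, hw⟩ := mem_nonloops.1 h
    have hqx : q ≠ x := fun h => hxK (h ▸ hq)
    have hqy : q ≠ y := fun h => hyK (h ▸ hq)
    rcases hb.exchange x q y w hxy hw with h3 | h3
    · exact hyK (h1 y q ⟨hqx, hqy, Or.inr ⟨rfl, h3⟩⟩ hq)
    · exact hxK (h1 x q ⟨hqx, hqy, Or.inl ⟨rfl, h3⟩⟩ hq)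
  · rintro rfl
    refine ⟨fun p q hpq hq => ?_, ?_⟩
    · rw [mem_singleton] at hq
      subst hq
      refine absurd (mem_nonloops.2 ?_) hm
      rcases hpq.2.2 with h | h
      · exact ⟨y, h.2⟩
      · exact ⟨x, hb.symm _ _ h.2⟩
    · rw [Finset.inter_singleton_of_mem]
      exact (hb.mem_minimals_empty hxy).2 (Or.inr (Or.inr hm))

/-- The number of subsets of `X` with `a` elements that contain `x`. -/
theorem card_filter_mem_subset {x : E} {X : Finset E} (hx : x ∈ X) {a : ℕ} (ha : 1 ≤ a) :
    #(univ.filter fun K : Finset E => #K = a ∧ x ∈ K ∧ K ⊆ X) = (#X - 1).choose (a - 1) := by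
  rw [← Finset.card_erase_of_mem hx, ← Finset.card_powersetCard]
  refine Finset.card_nbij' (fun K => K.erase x) (fun A => insert x A) ?_ ?_ ?_ ?_
  · intro K hK
    obtain ⟨-, h1, h2, h3⟩ := mem_filter.1 hK
    exact mem_powersetCard.2 ⟨Finset.erase_subset_erase x h3, by
      rw [Finset.card_erase_of_mem h2, h1]⟩
  · intro A hA
    obtain ⟨h1, h2⟩ := mem_powersetCard.1 hA
    refine mem_filter.2 ⟨mem_univ _, ?_, mem_insert_self _ _, ?_⟩
    · rw [Finset.card_insert_of_notMem fun h => notMem_erase x X (h1 h), h2]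
      omega
    · exact insert_subset hx (h1.trans (erase_subset _ _))
  · intro K hK
    exact Finset.insert_erase (mem_filter.1 hK).2.2.1
  · intro A hA
    exact Finset.erase_insert fun h => notMem_erase x X ((mem_powersetCard.1 hA).1 h)

theorem card_pointedLower_filter (r : E → E → Prop) (a : ℕ) (p : Finset E → Prop)
    [DecidablePred p] :
    #((pointedLower r a).filter p) = ∑ m ∈ minimals r ∅, #(univ.filter fun K : Finset E =>
      (IsLower r K ∧ minimals r ∅ ∩ K = {m}) ∧ #K = a ∧ p K) := by
  rw [← Finset.card_biUnion]
  · congr 1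
    ext K
    simp only [pointedLower, mem_filter, mem_univ, true_and, mem_biUnion, Finset.card_eq_one]
    constructor
    · rintro ⟨⟨h1, h2, m, h3⟩, h4⟩
      refine ⟨m, ?_, ⟨h1, h3⟩, h2, h4⟩
      have : m ∈ minimals r ∅ ∩ K := by rw [h3]; exact mem_singleton_self m
      exact (mem_inter.1 this).1
    · rintro ⟨m, -, ⟨h1, h3⟩, h2, h4⟩
      exact ⟨⟨h1, h2, m, h3⟩, h4⟩
  · intro m _ m' _ hne
    refine Finset.disjoint_left.2 fun K hK hK' => hne ?_
    have h1 := (mem_filter.1 hK).2.1.2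
    rw [(mem_filter.1 hK').2.1.2] at h1
    exact (singleton_injective h1).symm

theorem IsExchange.sum_minimals (hb : IsExchange b) {x y : E} (hxy : b x y) (g : E → ℕ) :
    ∑ m ∈ minimals (pairLT b x y) ∅, g m = g x + g y + ∑ m ∈ (nonloops b)ᶜ, g m := by
  have hne : x ≠ y := by
    rintro rfl
    exact hb.irrefl _ hxy
  have hx : x ∈ nonloops b := mem_nonloops.2 ⟨y, hxy⟩
  have hy : y ∈ nonloops b := mem_nonloops.2 ⟨x, hb.symm _ _ hxy⟩
  have : minimals (pairLT b x y) ∅ = insert x (insert y (nonloops b)ᶜ) := by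
    ext q
    rw [hb.mem_minimals_empty hxy, mem_insert, mem_insert, mem_compl]
  rw [this, Finset.sum_insert (by simp [hne, hx]), Finset.sum_insert (by simp [hy]), add_assoc]

/-- The set is sorted by its minimal element: for `x` and `y` the other a - 1 elements are chosen
freely from the rest of the class, and loops give only singletons. -/
theorem IsExchange.card_pointedLower (hb : IsExchange b) {x y : E} (hxy : b x y) {a : ℕ}
    (ha : 1 ≤ a) :
    #(pointedLower (pairLT b x y) a) =
      (#(parallelClass b x) - 1).choose (a - 1) + (#(parallelClass b y) - 1).choose (a - 1) +
        if a = 1 then #(nonloops b)ᶜ else 0 := by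
  have h := card_pointedLower_filter (pairLT b x y) a fun _ => True
  rw [Finset.filter_true, hb.sum_minimals hxy] at h
  have hside : ∀ {x y : E}, b x y → #(univ.filter fun K : Finset E => (IsLower (pairLT b x y) K ∧
      minimals (pairLT b x y) ∅ ∩ K = {x}) ∧ #K = a ∧ True) =
        (#(parallelClass b x) - 1).choose (a - 1) := fun {x y} hxy => by
    rw [← card_filter_mem_subset (hb.self_mem_parallelClass (mem_nonloops.2 ⟨y, hxy⟩)) ha]
    congr 1
    ext K
    simp only [mem_filter, mem_univ, true_and, and_true, hb.lower_iff_left hxy]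
    tauto
  rw [h, hside hxy]
  congr 1
  · congr 1
    rw [← hside (hb.symm _ _ hxy), hb.pairLT_comm]
  · have hloop : ∀ m ∈ (nonloops b)ᶜ, #(univ.filter fun K : Finset E =>
        (IsLower (pairLT b x y) K ∧ minimals (pairLT b x y) ∅ ∩ K = {m}) ∧ #K = a ∧ True) =
        if a = 1 then 1 else 0 := fun m hm => by
      simp only [hb.lower_iff_loop hxy (mem_compl.1 hm)]
      split_ifs with h1
      · rw [Finset.card_eq_one]
        refine ⟨{m}, ?_⟩
        ext K
        simp only [mem_filter, mem_univ, true_and, and_true, mem_singleton]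
        refine ⟨fun h => h.1, ?_⟩
        rintro rfl
        exact ⟨rfl, by rw [card_singleton, h1]⟩
      · rw [Finset.card_eq_zero]
        ext K
        simp only [mem_filter, mem_univ, true_and, and_true, notMem_empty, iff_false]
        rintro ⟨rfl, h⟩
        exact h1 (by rw [← h, card_singleton])
    rw [Finset.sum_congr rfl hloop, Finset.sum_const, smul_eq_mul]
    split_ifs <;> simp

/-- If the set with minimal element `x` misses some element of the class of `x`, that element and
`y` are both minimal in the complement. So the whole class is forced; in the absence of loops its
complement then has `y` as its only minimal element. -/
theorem IsExchange.card_pointedLower_filter (hb : IsExchange b) (hl : ∀ x, ∃ y, b x y) {x y : E}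
    (hxy : b x y) (a : ℕ) :
    #((pointedLower (pairLT b x y) a).filter fun K => #(minimals (pairLT b x y) K) = 1) =
      (if #(parallelClass b x) = a then 1 else 0) +
        (if #(parallelClass b y) = a then 1 else 0) := by
  rw [MatroidQSym.card_pointedLower_filter, hb.sum_minimals hxy]
  have hcompl : (nonloops b)ᶜ = ∅ := by
    ext q
    simp [mem_nonloops, hl]
  rw [hcompl, sum_empty, add_zero]
  have hside : ∀ {x y : E}, b x y → #(univ.filter fun K : Finset E => (IsLower (pairLT b x y) K ∧
      minimals (pairLT b x y) ∅ ∩ K = {x}) ∧ #K = a ∧ #(minimals (pairLT b x y) K) = 1) =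
        if #(parallelClass b x) = a then 1 else 0 := fun {x y} hxy => by
    have hset : (univ.filter fun K : Finset E => (IsLower (pairLT b x y) K ∧
        minimals (pairLT b x y) ∅ ∩ K = {x}) ∧ #K = a ∧ #(minimals (pairLT b x y) K) = 1) =
        ({parallelClass b x} : Finset (Finset E)).filter fun K => #K = a := by
      ext K
      simp only [mem_filter, mem_univ, true_and, hb.lower_iff_left hxy, mem_singleton]
      constructor
      · rintro ⟨⟨hx, hK⟩, h1, h2⟩
        refine ⟨hK.antisymm fun q hq => ?_, h1⟩
        by_contra hqK
        have hqx : q ≠ x := fun h => hqK (h ▸ hx)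
        have hqy : q ≠ y := fun h => (mem_parallelClass.1 hq).2 (h ▸ hxy)
        refine hqy (Finset.card_le_one.1 h2.le q ?_ y ?_)
        · refine mem_minimals.2 ⟨hqK, fun p hp => ?_⟩
          rcases hp.2.2 with h | h
          · exact h.1 ▸ hx
          · exact absurd h.2 (mem_parallelClass.1 hq).2
        · exact mem_minimals.2 ⟨fun h => (mem_parallelClass.1 (hK h)).2 hxy,
            fun p hp => absurd rfl hp.2.1⟩
      · rintro ⟨rfl, h1⟩
        refine ⟨⟨hb.self_mem_parallelClass (mem_nonloops.2 ⟨y, hxy⟩), Subset.rfl⟩, h1, ?_⟩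
        rw [Finset.card_eq_one]
        have hy : y ∉ parallelClass b x := fun h => (mem_parallelClass.1 h).2 hxy
        refine ⟨y, Finset.eq_singleton_iff_unique_mem.2 ⟨mem_minimals.2 ⟨hy,
          fun p hp => absurd rfl hp.2.1⟩, fun q hq => ?_⟩⟩
        rw [mem_minimals] at hq
        by_contra hqy
        have hbq : b x q := by
          by_contra h
          exact hq.1 (mem_parallelClass.2 ⟨hl q, h⟩)
        have hqx : q ≠ x := by
          rintro rfl
          exact hb.irrefl _ hbq
        exact hy (hq.2 y ⟨hqx, hqy, Or.inr ⟨rfl, hbq⟩⟩)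
    rw [hset, Finset.filter_singleton]
    split_ifs <;> simp
  rw [hside hxy, ← hside (hb.symm _ _ hxy), hb.pairLT_comm]

end RankTwo

/-! ### The sizes of the parallel classes -/

section Invariants

open scoped Classical

variable {E E' : Type*} [Fintype E] [Fintype E'] {b : E → E → Prop} {b' : E' → E' → Prop}

/-- The ordered pairs of elements that form a base. -/
def basePairs (b : E → E → Prop) : Finset (E × E) := univ.filter fun p => b p.1 p.2

/-- The number of elements whose parallel class has `s` elements. -/
def classCount (b : E → E → Prop) (s : ℕ) : ℕ :=
  #((nonloops b).filter fun x => #(parallelClass b x) = s)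

theorem mem_basePairs {p : E × E} : p ∈ basePairs b ↔ b p.1 p.2 := by simp [basePairs]

theorem card_filter_add_card_parallelClass (hb : IsExchange b) (x : E) :
    #(univ.filter (b x)) + #(parallelClass b x) = #(nonloops b) := by
  have : univ.filter (b x) = (nonloops b).filter (b x) := by
    ext y
    simp only [mem_filter, mem_univ, true_and, mem_nonloops]
    exact ⟨fun h => ⟨⟨x, hb.symm _ _ h⟩, h⟩, fun h => h.2⟩
  rw [this, parallelClass, Finset.card_filter_add_card_filter_not]

theorem card_parallelClass_lt (hb : IsExchange b) {x y : E} (hxy : b x y) :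
    #(parallelClass b x) < #(nonloops b) := by
  have h1 := card_filter_add_card_parallelClass hb x
  have h2 : 0 < #(univ.filter (b x)) := Finset.card_pos.2 ⟨y, by simp [hxy]⟩
  omega

theorem card_parallelClass_pos (hb : IsExchange b) {x : E} (hx : x ∈ nonloops b) :
    0 < #(parallelClass b x) := Finset.card_pos.2 ⟨x, hb.self_mem_parallelClass hx⟩

theorem classCount_zero (hb : IsExchange b) : classCount b 0 = 0 := by
  rw [classCount, Finset.card_eq_zero, Finset.filter_eq_empty_iff]
  exact fun x hx => (card_parallelClass_pos hb hx).ne'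

theorem classCount_eq_zero (hb : IsExchange b) {s : ℕ} (hs : #(nonloops b) ≤ s) :
    classCount b s = 0 := by
  rw [classCount, Finset.card_eq_zero, Finset.filter_eq_empty_iff]
  intro x hx
  obtain ⟨y, hy⟩ := mem_nonloops.1 hx
  have := card_parallelClass_lt hb hy
  omega

/-- An element whose class has s elements forms a base with each of the remaining nonloops. -/
theorem sum_basePairs_fst (hb : IsExchange b) (φ : ℕ → ℕ) :
    ∑ p ∈ basePairs b, φ #(parallelClass b p.1) =
      ∑ s ∈ range #(nonloops b), classCount b s * ((#(nonloops b) - s) * φ s) := by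
  have h1 : ∑ p ∈ basePairs b, φ #(parallelClass b p.1) =
      ∑ x ∈ nonloops b, #(univ.filter (b x)) * φ #(parallelClass b x) := by
    rw [basePairs, Finset.sum_filter, ← Finset.univ_product_univ, Finset.sum_product]
    symm
    refine (Finset.sum_subset (subset_univ _) fun x _ hx => ?_).trans
      (Finset.sum_congr rfl fun x _ => ?_)
    · rw [Finset.filter_eq_empty_iff.2 fun y _ h => hx (mem_nonloops.2 ⟨y, h⟩)]
      simp
    · simp only
      rw [← Finset.sum_filter, Finset.sum_const, smul_eq_mul]
  have hmaps : ∀ x ∈ nonloops b, #(parallelClass b x) ∈ range #(nonloops b) := fun x hx => by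
    obtain ⟨y, hy⟩ := mem_nonloops.1 hx
    exact mem_range.2 (card_parallelClass_lt hb hy)
  rw [h1, ← Finset.sum_fiberwise_of_maps_to hmaps]
  refine Finset.sum_congr rfl fun s _ => ?_
  rw [classCount, ← smul_eq_mul #(filter _ _), ← Finset.sum_const]
  refine Finset.sum_congr rfl fun x hx => ?_
  have := card_filter_add_card_parallelClass hb x
  rw [← (mem_filter.1 hx).2]
  congr 1
  omega

theorem sum_basePairs_snd (hb : IsExchange b) (g : E → ℕ) :
    ∑ p ∈ basePairs b, g p.2 = ∑ p ∈ basePairs b, g p.1 := by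
  refine Finset.sum_nbij' Prod.swap Prod.swap ?_ ?_ ?_ ?_ ?_ <;> intro p hp
  · exact mem_basePairs.2 (hb.symm _ _ (mem_basePairs.1 hp))
  · exact mem_basePairs.2 (hb.symm _ _ (mem_basePairs.1 hp))
  · rfl
  · rfl
  · rfl

/-- Twice the value at a word of the function of a matroid of rank two. -/
def basePairsValue (b : E → E → Prop) (u : WordAlgebra) : ℚ :=
  ∑ p ∈ basePairs b, chainMatrix (pairLT b p.1 p.2) u ∅ univ

theorem basePairsValue_signWord (b : E → E → Prop) (d : ℕ) :
    basePairsValue b (signWord d) =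
      if Fintype.card E = d then (-1) ^ d * (#(basePairs b) : ℚ) else 0 := by
  have h : ∀ p ∈ basePairs b, chainMatrix (pairLT b p.1 p.2) (signWord d) ∅ univ =
      if Fintype.card E = d then (-1) ^ d else 0 := fun p _ => by
    rw [chainMatrix_signWord (wellFounded_pairLT _ _ _) (isLower_univ _), sdiff_empty,
      Finset.card_univ]
    simp
  rw [basePairsValue, Finset.sum_congr rfl h, Finset.sum_const, nsmul_eq_mul]
  split_ifs
  · ring
  · rw [mul_zero]

theorem basePairsValue_powerSum_mul_signWord (hb : IsExchange b) {a c : ℕ} (ha : 1 ≤ a)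
    (hac : a + c = Fintype.card E) :
    basePairsValue b (powerSum a * signWord c) = -(-1) ^ Fintype.card E *
      ((2 * (∑ s ∈ range #(nonloops b),
          classCount b s * ((#(nonloops b) - s) * (s - 1).choose (a - 1))) +
        (if a = 1 then #(nonloops b)ᶜ else 0) * #(basePairs b) : ℕ) : ℚ) := by
  have h : ∀ p ∈ basePairs b,
      chainMatrix (pairLT b p.1 p.2) (powerSum a * signWord c) ∅ univ =
      -(-1) ^ Fintype.card E * (((#(parallelClass b p.1) - 1).choose (a - 1) +
        (#(parallelClass b p.2) - 1).choose (a - 1) +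
          (if a = 1 then #(nonloops b)ᶜ else 0) : ℕ) : ℚ) := fun p hp => by
    rw [chainMatrix_powerSum_mul_signWord (wellFounded_pairLT _ _ _) hac,
      hb.card_pointedLower (mem_basePairs.1 hp) ha]
  rw [basePairsValue, Finset.sum_congr rfl h, ← Finset.mul_sum, ← Nat.cast_sum,
    Finset.sum_add_distrib, Finset.sum_add_distrib,
    sum_basePairs_snd hb fun x => (#(parallelClass b x) - 1).choose (a - 1),
    sum_basePairs_fst hb fun s => (s - 1).choose (a - 1), Finset.sum_const, smul_eq_mul, two_mul,
    mul_comm #(basePairs b)]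

/-- Each of the `classCount b a` elements with class size `a` has `c` partners, and the factor two
comes from the two sides of a base. -/
theorem basePairsValue_powerSum_mul_powerSum (hb : IsExchange b) (hl : ∀ x, ∃ y, b x y)
    (a c : ℕ) :
    basePairsValue b (powerSum a * powerSum c) =
      if a + c = Fintype.card E then
        (-1 : ℚ) ^ Fintype.card E * (2 * (c * classCount b a)) else 0 := by
  have hN : #(nonloops b) = Fintype.card E := by
    rw [← Finset.card_univ]
    congr 1
    ext x
    simp [mem_nonloops, hl]
  have h : ∀ p ∈ basePairs b,
      chainMatrix (pairLT b p.1 p.2) (powerSum a * powerSum c) ∅ univ =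
      if a + c = Fintype.card E then
        (-1) ^ Fintype.card E * (((if #(parallelClass b p.1) = a then 1 else 0) +
        (if #(parallelClass b p.2) = a then 1 else 0) : ℕ) : ℚ) else 0 := fun p hp => by
    rw [chainMatrix_powerSum_mul_powerSum (wellFounded_pairLT _ _ _),
      hb.card_pointedLower_filter hl (mem_basePairs.1 hp)]
  rw [basePairsValue, Finset.sum_congr rfl h]
  split_ifs with hac
  · rw [← Finset.mul_sum, ← Nat.cast_sum, Finset.sum_add_distrib,
      sum_basePairs_snd hb fun x => if #(parallelClass b x) = a then 1 else 0,
      sum_basePairs_fst hb fun s => if s = a then 1 else 0]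
    have h2 : ∑ s ∈ range #(nonloops b), classCount b s * ((#(nonloops b) - s) *
        if s = a then 1 else 0) = c * classCount b a := by
      simp only [mul_ite, mul_one, mul_zero, Finset.sum_ite_eq', mem_range, hN]
      split_ifs with ha
      · rw [mul_comm]
        congr 1
        omega
      · rw [classCount_eq_zero hb (by omega), mul_zero]
    rw [h2]
    push_cast
    ring
  · exact Finset.sum_const_zero

/-- The system is triangular: equation `a = s` does not involve smaller positive indices and has the
diagonal coefficient N - s > 0, so one solves downwards from N - 1. -/
theorem eq_of_sum_choose_eq {N : ℕ} {ν ν' : ℕ → ℕ} (h0 : ν 0 = ν' 0)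
    (h : ∀ a, 1 ≤ a → a < N → ∑ s ∈ range N, ν s * ((N - s) * (s - 1).choose (a - 1)) =
      ∑ s ∈ range N, ν' s * ((N - s) * (s - 1).choose (a - 1))) {s : ℕ} (hs : s < N) :
    ν s = ν' s := by
  induction hk : N - s using Nat.strong_induction_on generalizing s with
  | _ k ih =>
    rcases Nat.eq_zero_or_pos s with rfl | hpos
    · exact h0
    have := h s hpos hs
    rw [← Finset.add_sum_erase _ _ (mem_range.2 hs),
      ← Finset.add_sum_erase (range N) (fun t => ν' t * _) (mem_range.2 hs)] at this
    have hrest : ∑ t ∈ (range N).erase s, ν t * ((N - t) * (t - 1).choose (s - 1)) =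
        ∑ t ∈ (range N).erase s, ν' t * ((N - t) * (t - 1).choose (s - 1)) := by
      refine Finset.sum_congr rfl fun t ht => ?_
      obtain ⟨hne, ht⟩ := mem_erase.1 ht
      rw [mem_range] at ht
      -- Truncated subtraction makes the binomial coefficient at t = 0 equal to 1 when s = 1, so
      -- this index relies on `h0`.
      rcases Nat.eq_zero_or_pos t with rfl | htpos
      · rw [h0]
      rcases lt_or_gt_of_ne hne with hlt | hgt
      · rw [Nat.choose_eq_zero_of_lt (by omega), mul_zero, mul_zero, mul_zero]
      · rw [ih (N - t) (by omega) ht rfl]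
    rw [hrest, Nat.choose_self, mul_one] at this
    exact Nat.eq_of_mul_eq_mul_right (by omega) (Nat.add_right_cancel this)

theorem sum_classCount_mul (hb : IsExchange b) :
    ∑ s ∈ range #(nonloops b), classCount b s * ((#(nonloops b) - s) * (s - 1).choose (1 - 1)) =
      #(basePairs b) := by
  rw [← sum_basePairs_fst hb fun s => (s - 1).choose (1 - 1)]
  simp

/-- The values at the sign words give the number of elements and of bases. At a = 1 the sum over
classes is again the number of bases, which isolates the number of loops; the values at larger `a`
complete the triangular system for the class sizes. -/
theorem invariants_eq (hb : IsExchange b) (hb' : IsExchange b') (hne : (basePairs b).Nonempty)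
    (h : ∀ u, basePairsValue b u = basePairsValue b' u) :
    #(nonloops b)ᶜ = #(nonloops b')ᶜ ∧ ∀ s, classCount b s = classCount b' s := by
  have hD : 0 < #(basePairs b) := Finset.card_pos.2 hne
  have h1 := h (signWord (Fintype.card E))
  rw [basePairsValue_signWord, basePairsValue_signWord, if_pos rfl] at h1
  have hpow : ((-1 : ℚ)) ^ Fintype.card E ≠ 0 := pow_ne_zero _ (by norm_num)
  have hn : Fintype.card E' = Fintype.card E := by
    by_contra hn
    rw [if_neg hn, mul_eq_zero] at h1
    rcases h1 with h1 | h1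
    · exact hpow h1
    · rw [Nat.cast_eq_zero] at h1
      omega
  rw [if_pos hn] at h1
  have hDD : #(basePairs b) = #(basePairs b') := by exact_mod_cast mul_left_cancel₀ hpow h1
  have h2 : ∀ a, 1 ≤ a → a ≤ Fintype.card E →
      2 * (∑ s ∈ range #(nonloops b),
          classCount b s * ((#(nonloops b) - s) * (s - 1).choose (a - 1))) +
        (if a = 1 then #(nonloops b)ᶜ else 0) * #(basePairs b) =
      2 * (∑ s ∈ range #(nonloops b'),
          classCount b' s * ((#(nonloops b') - s) * (s - 1).choose (a - 1))) +
        (if a = 1 then #(nonloops b')ᶜ else 0) * #(basePairs b') := fun a ha han => by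
    have h3 := h (powerSum a * signWord (Fintype.card E - a))
    rw [basePairsValue_powerSum_mul_signWord hb ha (by omega),
      basePairsValue_powerSum_mul_signWord hb' ha (by omega), hn] at h3
    exact_mod_cast mul_left_cancel₀ (neg_ne_zero.2 hpow) h3
  have hE : 1 ≤ Fintype.card E := by
    obtain ⟨p, -⟩ := hne
    exact Fintype.card_pos_iff.2 ⟨p.1⟩
  have hl : #(nonloops b)ᶜ = #(nonloops b')ᶜ := by
    have h3 := h2 1 le_rfl hE
    rw [sum_classCount_mul hb, sum_classCount_mul hb', ← hDD, if_pos rfl, if_pos rfl] at h3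
    exact Nat.eq_of_mul_eq_mul_right hD (Nat.add_left_cancel h3)
  have hN : #(nonloops b) = #(nonloops b') := by
    have h3 := Finset.card_add_card_compl (nonloops b)
    have h4 := Finset.card_add_card_compl (nonloops b')
    omega
  refine ⟨hl, fun s => ?_⟩
  by_cases hs : s < #(nonloops b)
  · refine eq_of_sum_choose_eq (by rw [classCount_zero hb, classCount_zero hb'])
      (fun a ha haN => ?_) hs
    have h3 := h2 a ha (haN.le.trans (Finset.card_le_univ _))
    rw [hl, hDD, ← hN] at h3
    omega
  · rw [classCount_eq_zero hb (not_lt.1 hs), classCount_eq_zero hb' (hN ▸ not_lt.1 hs)]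

theorem sum_classCount (hb : IsExchange b) (hl : ∀ x, ∃ y, b x y) :
    ∑ s ∈ range (Fintype.card E), classCount b s = Fintype.card E := by
  have hN : nonloops b = univ := by
    ext x
    simp [mem_nonloops, hl]
  rw [← Finset.card_univ (α := E), ← hN]
  refine (Finset.card_eq_sum_card_fiberwise fun x hx => ?_).symm
  obtain ⟨y, hy⟩ := hl x
  exact mem_coe.2 (mem_range.2 (card_parallelClass_lt hb hy))

theorem IsExchange.parallelClass_eq (hb : IsExchange b) {x y : E} (hx : x ∈ nonloops b)
    (hy : y ∈ nonloops b) (h : ¬ b x y) : parallelClass b x = parallelClass b y := by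
  obtain ⟨w, hw⟩ := mem_nonloops.1 hx
  obtain ⟨w', hw'⟩ := mem_nonloops.1 hy
  ext q
  rw [mem_parallelClass, mem_parallelClass, not_iff_not.2 ?_]
  constructor
  · intro hq
    exact (hb.exchange x y q w' hq hw').resolve_left h
  · intro hq
    exact (hb.exchange y x q w hq hw).resolve_left fun h' => h (hb.symm _ _ h')

/-- The classes of `x` and `y` are disjoint, and the third element lies in neither. -/
theorem card_parallelClass_add_lt (hb : IsExchange b)
    (h3 : ∀ x y, b x y → ∃ z, b x z ∧ b y z) {x y : E} (hxy : b x y) :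
    #(parallelClass b x) + #(parallelClass b y) < Fintype.card E := by
  obtain ⟨z, hxz, hyz⟩ := h3 x y hxy
  have hdisj : Disjoint (parallelClass b x) (parallelClass b y) := by
    refine Finset.disjoint_left.2 fun q hx hy => ?_
    rw [mem_parallelClass] at hx hy
    obtain ⟨⟨w, hw⟩, hx⟩ := hx
    rcases hb.exchange x q y w hxy hw with h | h
    · exact hx h
    · exact hy.2 (hb.symm _ _ h)
  rw [← Finset.card_union_of_disjoint hdisj, ← Finset.card_univ]
  refine Finset.card_lt_card ((Finset.ssubset_univ_iff).2 fun h => ?_)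
  have := mem_univ z
  rw [← h, mem_union, mem_parallelClass, mem_parallelClass] at this
  tauto

theorem classCount_mul_classCount (hb : IsExchange b)
    (h3 : ∀ x y, b x y → ∃ z, b x z ∧ b y z) {s t : ℕ} (hst : s + t = Fintype.card E)
    (hne : s ≠ t) : classCount b s = 0 ∨ classCount b t = 0 := by
  by_contra! h
  obtain ⟨x, hx⟩ := Finset.card_pos.1 (Nat.pos_of_ne_zero h.1)
  obtain ⟨y, hy⟩ := Finset.card_pos.1 (Nat.pos_of_ne_zero h.2)
  rw [mem_filter] at hx hy
  have hxy : b x y := by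
    by_contra hxy
    have := hb.parallelClass_eq hx.1 hy.1 hxy
    rw [this] at hx
    exact hne (hx.2.symm.trans hy.2)
  have := card_parallelClass_add_lt hb h3 hxy
  omega

/-- For a + c = n the commutator gives the difference c·ν(a) - a·ν(c), in which at most one term is
nonzero if a ≠ c. The number of elements is itself recovered: if it differed, all these differences
would vanish. -/
theorem classCount_eq_of_commutator (hb : IsExchange b) (hb' : IsExchange b')
    (hl : ∀ x, ∃ y, b x y) (hl' : ∀ x, ∃ y, b' x y)
    (h3 : ∀ x y, b x y → ∃ z, b x z ∧ b y z) (h3' : ∀ x y, b' x y → ∃ z, b' x z ∧ b' y z)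
    (hne : (basePairs b).Nonempty)
    (h : ∀ a c, basePairsValue b (powerSum a * powerSum c) -
        basePairsValue b (powerSum c * powerSum a) =
      basePairsValue b' (powerSum a * powerSum c) - basePairsValue b' (powerSum c * powerSum a))
    (s : ℕ) : classCount b s = classCount b' s := by
  have hpow : ∀ n, ((-1 : ℚ)) ^ n ≠ 0 := fun n => pow_ne_zero _ (by norm_num)
  have hN : #(nonloops b) = Fintype.card E := by
    rw [← Finset.card_univ]
    congr 1
    ext x
    simp [mem_nonloops, hl]
  have hN' : #(nonloops b') = Fintype.card E' := by
    rw [← Finset.card_univ]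
    congr 1
    ext x
    simp [mem_nonloops, hl']
  simp only [basePairsValue_powerSum_mul_powerSum hb hl,
    basePairsValue_powerSum_mul_powerSum hb' hl'] at h
  by_cases hn : Fintype.card E = Fintype.card E'
  -- The equality of differences, rearranged so that it can be used without subtraction of natural
  -- numbers.
  · have hrel : ∀ a c, a + c = Fintype.card E →
        c * classCount b a + a * classCount b' c = c * classCount b' a + a * classCount b c := by
      intro a c hac
      have h1 := h a c
      rw [if_pos hac, if_pos ((add_comm c a).trans hac), if_pos (hac.trans hn),
        if_pos ((add_comm c a).trans (hac.trans hn)), ← hn, ← mul_sub, ← mul_sub, ← mul_sub] at h1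
      have h2 := mul_left_cancel₀ (hpow _) h1
      have h4 : (c * classCount b a + a * classCount b' c : ℚ) =
          c * classCount b' a + a * classCount b c := by linarith
      exact_mod_cast h4
    have hoff : ∀ s, s < Fintype.card E → 2 * s ≠ Fintype.card E →
        classCount b s = classCount b' s := by
      intro s hs hs2
      obtain ⟨t, ht⟩ := Nat.exists_eq_add_of_lt hs
      have hst : s + (t + 1) = Fintype.card E := by omega
      have h1 := hrel s (t + 1) hst
      rcases Nat.eq_zero_or_pos s with rfl | hspos
      · rw [classCount_zero hb, classCount_zero hb']
      have h2 := classCount_mul_classCount hb h3 hst (by omega)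
      have h4 := classCount_mul_classCount hb' h3' (hst.trans hn) (by omega)
      -- If different terms vanish on the two sides, a nonnegative number equals a nonpositive one
      -- and both are zero.
      have hcancel : (t + 1) * classCount b s = (t + 1) * classCount b' s := by
        rcases h2 with h2 | h2 <;> rcases h4 with h4 | h4 <;> rw [h2, h4] at h1
        · rw [h2, h4]
        · simp only [mul_zero, zero_add] at h1
          have : s * classCount b (t + 1) = 0 ∧ (t + 1) * classCount b' s = 0 := by omega
          rw [h2, this.2, mul_zero]
        · simp only [mul_zero, add_zero] at h1
          have : s * classCount b' (t + 1) = 0 ∧ (t + 1) * classCount b s = 0 := by omega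
          rw [h4, this.2, mul_zero]
        · simpa using h1
      exact Nat.eq_of_mul_eq_mul_left (Nat.succ_pos t) hcancel
    by_cases hs : s < Fintype.card E
    · by_cases hs2 : 2 * s = Fintype.card E
      -- At s = n/2 the commutator is zero and says nothing; the total number of elements supplies
      -- this value.
      · have h5 := sum_classCount hb hl
        have h6 := sum_classCount hb' hl'
        rw [← hn] at h6
        rw [← Finset.add_sum_erase _ _ (mem_range.2 hs)] at h5 h6
        have h7 : ∑ t ∈ (range (Fintype.card E)).erase s, classCount b' t =
            ∑ t ∈ (range (Fintype.card E)).erase s, classCount b t := by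
          refine Finset.sum_congr rfl fun t ht => ?_
          obtain ⟨hne, ht⟩ := mem_erase.1 ht
          exact (hoff t (mem_range.1 ht) (by omega)).symm
        omega
      · exact hoff s hs hs2
    · rw [classCount_eq_zero hb (by omega), classCount_eq_zero hb' (by omega)]
  · exfalso
    obtain ⟨⟨x, y⟩, hp⟩ := hne
    have hxy : b x y := mem_basePairs.1 hp
    -- With unequal numbers of elements the second matroid contributes zero, which forces every
    -- class of the first to have exactly n/2 elements; two classes would then exhaust the ground
    -- set.
    have hhalf : ∀ x, 2 * #(parallelClass b x) = Fintype.card E := by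
      intro x
      by_contra hx2
      obtain ⟨y, hxy⟩ := hl x
      have hx : x ∈ nonloops b := mem_nonloops.2 ⟨y, hxy⟩
      have hlt := card_parallelClass_lt hb hxy
      rw [hN] at hlt
      obtain ⟨t, ht⟩ := Nat.exists_eq_add_of_lt hlt
      set s := #(parallelClass b x) with hs
      have hst : s + (t + 1) = Fintype.card E := by omega
      have hpos : classCount b s ≠ 0 :=
        (Finset.card_pos.2 ⟨x, mem_filter.2 ⟨hx, hs.symm⟩⟩).ne'
      have h2 := (classCount_mul_classCount hb h3 hst (by omega)).resolve_left hpos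
      have h1 := h s (t + 1)
      rw [if_pos hst, if_pos ((add_comm _ _).trans hst), if_neg (by omega), if_neg (by omega),
        h2] at h1
      simp only [Nat.cast_zero, mul_zero, sub_zero, mul_eq_zero] at h1
      rcases h1 with h1 | h1 | h1 | h1
      · exact hpow _ h1
      · norm_num at h1
      · rw [Nat.cast_eq_zero] at h1
        omega
      · exact hpos (by exact_mod_cast h1)
    have h1 := card_parallelClass_add_lt hb h3 hxy
    have h2 := hhalf x
    have h4 := hhalf y
    omega

end Invariants

/-! ### Reconstruction from the sizes of the parallel classes -/

section Reconstruction

open scoped Classical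

variable {E E' : Type*} [Fintype E] [Fintype E'] {b : E → E → Prop} {b' : E' → E' → Prop}

/-- The parallel classes. -/
def classes (b : E → E → Prop) : Finset (Finset E) := (nonloops b).image (parallelClass b)

theorem IsExchange.rel_iff (hb : IsExchange b) {x y : E} (hx : x ∈ nonloops b)
    (hy : y ∈ nonloops b) : b x y ↔ parallelClass b x ≠ parallelClass b y := by
  refine ⟨fun h heq => ?_, fun h => ?_⟩
  · have := hb.self_mem_parallelClass hy
    rw [← heq] at this
    exact (mem_parallelClass.1 this).2 h
  · by_contra hxy
    exact h (hb.parallelClass_eq hx hy hxy)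

theorem IsExchange.filter_parallelClass_eq (hb : IsExchange b) {k : Finset E}
    (hk : k ∈ classes b) : ((nonloops b).filter fun x => parallelClass b x = k) = k := by
  obtain ⟨y, hy, rfl⟩ := mem_image.1 hk
  ext x
  rw [mem_filter]
  constructor
  · rintro ⟨hx, h⟩
    rw [← h]
    exact hb.self_mem_parallelClass hx
  · intro hx
    have hx' := mem_parallelClass.1 hx
    have hxn := mem_nonloops.2 hx'.1
    exact ⟨hxn, (hb.parallelClass_eq hy hxn hx'.2).symm⟩

/-- `classCount` counts elements, so each class of size `s` is counted `s` times. -/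
theorem IsExchange.card_classes_mul (hb : IsExchange b) (s : ℕ) :
    #((classes b).filter fun k => #k = s) * s = classCount b s := by
  rw [classCount, Finset.card_eq_sum_card_fiberwise (f := parallelClass b)
    (t := (classes b).filter fun k => #k = s)]
  · rw [← smul_eq_mul, ← Finset.sum_const]
    refine Finset.sum_congr rfl fun k hk => ?_
    obtain ⟨hk, hs⟩ := mem_filter.1 hk
    rw [Finset.filter_filter]
    have : ((nonloops b).filter fun x => #(parallelClass b x) = s ∧ parallelClass b x = k) =
        (nonloops b).filter fun x => parallelClass b x = k := by
      refine Finset.filter_congr fun x _ => ⟨fun h => h.2, fun h => ⟨h ▸ hs, h⟩⟩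
    rw [this, hb.filter_parallelClass_eq hk, hs]
  · intro x hx
    obtain ⟨hx, hs⟩ := mem_filter.1 (mem_coe.1 hx)
    exact mem_coe.2 (mem_filter.2 ⟨mem_image_of_mem _ hx, hs⟩)

theorem card_filter_subtype {γ : Type*} (S : Finset γ) (φ : γ → ℕ) (s : ℕ) :
    #(univ.filter fun k : {k // k ∈ S} => φ k.1 = s) = #(S.filter fun k => φ k = s) := by
  rw [← Finset.card_map (Function.Embedding.subtype _)]
  congr 1
  ext k
  simp [and_comm]

/-- Classes are matched by size and then elements within matched classes. Two elements are related
exactly if they are nonloops in different classes, so the relation is preserved. -/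
theorem exists_equiv_of_classCount_eq (hb : IsExchange b) (hb' : IsExchange b')
    (hl : #(nonloops b)ᶜ = #(nonloops b')ᶜ) (hc : ∀ s, classCount b s = classCount b' s) :
    ∃ e : E ≃ E', ∀ x y, b x y ↔ b' (e x) (e y) := by
  have hcard : ∀ s, #((classes b).filter fun k => #k = s) =
      #((classes b').filter fun k => #k = s) := fun s => by
    rcases Nat.eq_zero_or_pos s with rfl | hs
    · rw [Finset.filter_eq_empty_iff.2, Finset.filter_eq_empty_iff.2]
      · simp
      · intro k hk
        obtain ⟨x, hx, rfl⟩ := mem_image.1 hk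
        exact (card_parallelClass_pos hb' hx).ne'
      · intro k hk
        obtain ⟨x, hx, rfl⟩ := mem_image.1 hk
        exact (card_parallelClass_pos hb hx).ne'
    · have := hc s
      rw [← hb.card_classes_mul, ← hb'.card_classes_mul] at this
      exact Nat.eq_of_mul_eq_mul_right hs this
  obtain ⟨σ, hσ⟩ := exists_equiv_of_card_fiber
    (fun k : {k // k ∈ classes b} => #k.1) (fun k : {k // k ∈ classes b'} => #k.1) fun s => by
      rw [card_filter_subtype (classes b) card, card_filter_subtype (classes b') card, hcard]
  -- Each element is sent to its class, transported by `σ`, with `none` collecting the loops; equal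
  -- fiber sizes then produce the bijection.
  let f : E → Option {k // k ∈ classes b'} := fun x =>
    if hx : x ∈ nonloops b then some (σ ⟨parallelClass b x, mem_image_of_mem _ hx⟩) else none
  let g : E' → Option {k // k ∈ classes b'} := fun x =>
    if hx : x ∈ nonloops b' then some ⟨parallelClass b' x, mem_image_of_mem _ hx⟩ else none
  obtain ⟨e, he⟩ := exists_equiv_of_card_fiber f g fun o => by
    rcases o with _ | k'
    · have h1 : (univ.filter fun x => f x = none) = (nonloops b)ᶜ := by
        ext x
        simp [f]
      have h2 : (univ.filter fun x => g x = none) = (nonloops b')ᶜ := by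
        ext x
        simp [g]
      rw [h1, h2, hl]
    · obtain ⟨k, rfl⟩ := σ.surjective k'
      have h1 : (univ.filter fun x => f x = some (σ k)) = k.1 := by
        rw [← hb.filter_parallelClass_eq k.2]
        ext x
        by_cases hx : x ∈ nonloops b
        · simp [f, hx, Subtype.ext_iff]
        · simp [f, hx]
      have h2 : (univ.filter fun x => g x = some (σ k)) = (σ k).1 := by
        rw [← hb'.filter_parallelClass_eq (σ k).2]
        ext x
        by_cases hx : x ∈ nonloops b'
        · simp [g, hx, Subtype.ext_iff]
        · simp [g, hx]
      rw [h1, h2]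
      exact (hσ k).symm
  have hf : ∀ x, f x = none ↔ x ∉ nonloops b := fun x => by simp [f]
  have hg : ∀ x, g x = none ↔ x ∉ nonloops b' := fun x => by simp [g]
  have hfb : ∀ x y, b x y ↔ f x ≠ none ∧ f y ≠ none ∧ f x ≠ f y := by
    intro x y
    by_cases hx : x ∈ nonloops b
    · by_cases hy : y ∈ nonloops b
      · rw [hb.rel_iff hx hy]
        simp [f, hx, hy, Subtype.ext_iff]
      · have h1 : ¬ b x y := fun h => hy (mem_nonloops.2 ⟨x, hb.symm _ _ h⟩)
        simp [h1, (hf y).2 hy]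
    · have h1 : ¬ b x y := fun h => hx (mem_nonloops.2 ⟨y, h⟩)
      simp [h1, (hf x).2 hx]
  have hgb : ∀ x y, b' x y ↔ g x ≠ none ∧ g y ≠ none ∧ g x ≠ g y := by
    intro x y
    by_cases hx : x ∈ nonloops b'
    · by_cases hy : y ∈ nonloops b'
      · rw [hb'.rel_iff hx hy]
        simp [g, hx, hy, Subtype.ext_iff]
      · have h1 : ¬ b' x y := fun h => hy (mem_nonloops.2 ⟨x, hb'.symm _ _ h⟩)
        simp [h1, (hg y).2 hy]
    · have h1 : ¬ b' x y := fun h => hx (mem_nonloops.2 ⟨y, h⟩)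
      simp [h1, (hg x).2 hx]
  exact ⟨e, fun x y => by rw [hfb, hgb, he, he]⟩

end Reconstruction

/-! ### Matroids of rank two -/

section RankTwoMatroid

open scoped Classical

variable {α β : Type*} {M : Matroid α} {N : Matroid β}

/-- The pairs of elements that are bases of a matroid. -/
def matroidRel (M : Matroid α) (x y : M.E) : Prop := (x : α) ≠ y ∧ M.IsBase {(x : α), (y : α)}

theorem encard_of_isBase (hr : M.eRank = 2) {B : Set α} (hB : M.IsBase B) : B.encard = 2 := by
  rw [hB.encard_eq_eRank, hr]

theorem exists_eq_pair_of_isBase (hr : M.eRank = 2) {B : Set α} (hB : M.IsBase B) :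
    ∃ x y : M.E, matroidRel M x y ∧ B = {(x : α), (y : α)} := by
  obtain ⟨x, y, hne, rfl⟩ := Set.encard_eq_two.1 (encard_of_isBase hr hB)
  exact ⟨⟨x, hB.subset_ground (by simp)⟩, ⟨y, hB.subset_ground (by simp)⟩, ⟨hne, hB⟩, rfl⟩

theorem isBase_of_indep_pair (hr : M.eRank = 2) {x y : α} (hne : x ≠ y) (h : M.Indep {x, y}) :
    M.IsBase {x, y} := by
  obtain ⟨B, hB, hsub⟩ := h.exists_isBase_superset
  have : ({x, y} : Set α) = B := by
    refine (Set.toFinite _).eq_of_subset_of_encard_le hsub ?_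
    rw [encard_of_isBase hr hB, Set.encard_pair hne]
  rwa [this]

/-- The exchange law is augmentation of the independent singleton {y} from the base {x, z}. -/
theorem isExchange_matroidRel (hr : M.eRank = 2) : IsExchange (matroidRel M) where
  symm x y h := ⟨h.1.symm, by rw [Set.pair_comm]; exact h.2⟩
  irrefl x h := h.1 rfl
  exchange x y z w hxz hyw := by
    have hy : M.Indep {(y : α)} := hyw.2.indep.subset (by simp)
    have hlt : ({(y : α)} : Set α).encard < ({(x : α), (z : α)} : Set α).encard := by
      rw [Set.encard_singleton, Set.encard_pair hxz.1]
      norm_num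
    obtain ⟨e, he, hind⟩ := hy.augment hxz.2.indep hlt
    rcases he.1 with h | h
    · rw [Set.mem_singleton_iff.1 h] at hind he
      exact Or.inl ⟨fun h' => he.2 h', isBase_of_indep_pair hr (fun h' => he.2 h') hind⟩
    · rw [Set.mem_singleton_iff.1 h] at hind he
      refine Or.inr ⟨fun h' => he.2 h'.symm, ?_⟩
      rw [Set.pair_comm]
      exact isBase_of_indep_pair hr (fun h' => he.2 h') hind

theorem basePoset_lt_eq {x y : M.E} (hxy : matroidRel M x y) :
    (basePoset M {(x : α), (y : α)}).lt = pairLT (matroidRel M) x y := by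
  funext p q
  have hne := hxy.1
  simp only [pairLT, eq_iff_iff, matroidRel]
  change ((p : α) ∈ ({(x : α), (y : α)} : Set α) ∧ (q : α) ∉ ({(x : α), (y : α)} : Set α) ∧
    M.IsBase (insert (q : α) ({(x : α), (y : α)} \ {(p : α)}))) ↔ _
  have h1 : ({(x : α), (y : α)} \ {(x : α)} : Set α) = {(y : α)} := by
    ext z; simp; grind
  have h2 : ({(x : α), (y : α)} \ {(y : α)} : Set α) = {(x : α)} := by
    ext z; simp; grind
  constructor
  · rintro ⟨hp, hq, hB⟩
    simp only [Set.mem_insert_iff, Set.mem_singleton_iff, not_or] at hp hq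
    refine ⟨fun h => hq.1 (by rw [h]), fun h => hq.2 (by rw [h]), ?_⟩
    rcases hp with hp | hp
    · rw [hp, h1] at hB
      exact Or.inl ⟨Subtype.ext hp, hq.2, hB⟩
    · rw [hp, h2, Set.pair_comm] at hB
      exact Or.inr ⟨Subtype.ext hp, Ne.symm hq.1, hB⟩
  · rintro ⟨hqx, hqy, h⟩
    have hq : (q : α) ∉ ({(x : α), (y : α)} : Set α) := by
      simp only [Set.mem_insert_iff, Set.mem_singleton_iff, not_or]
      exact ⟨fun h => hqx (Subtype.ext h), fun h => hqy (Subtype.ext h)⟩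
    rcases h with ⟨rfl, -, h⟩ | ⟨rfl, -, h⟩
    · exact ⟨by simp, hq, by rwa [h1]⟩
    · exact ⟨by simp, hq, by rwa [h2, Set.pair_comm]⟩

/-- Each base arises from two ordered pairs, and both give the same poset. -/
theorem two_mul_pairing_matroidQSym [M.Finite] [Fintype M.E] (hr : M.eRank = 2)
    (u : WordAlgebra) : 2 * pairing u (matroidQSym M) = basePairsValue (matroidRel M) u := by
  rw [matroidQSym_eq M (baseLabeling M) fun B _ => baseLabeling_strict M B, map_sum, Finset.mul_sum,
    basePairsValue]
  have hmaps : ∀ p ∈ basePairs (matroidRel M), ({(p.1 : α), (p.2 : α)} : Set α) ∈ bases M :=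
    fun p hp => mem_bases.2 (mem_basePairs.1 hp).2
  rw [← Finset.sum_fiberwise_of_maps_to hmaps]
  refine Finset.sum_congr rfl fun B hB => ?_
  obtain ⟨x, y, hxy, rfl⟩ := exists_eq_pair_of_isBase hr (mem_bases.1 hB)
  have hset : ((basePairs (matroidRel M)).filter fun p =>
      ({(p.1 : α), (p.2 : α)} : Set α) = {(x : α), (y : α)}) = {(x, y), (y, x)} := by
    ext ⟨p, q⟩
    simp only [mem_filter, mem_basePairs, Set.pair_eq_pair_iff, mem_insert, mem_singleton,
      Prod.mk.injEq, Subtype.ext_iff]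
    constructor
    · exact fun h => h.2
    · rintro (⟨h1, h2⟩ | ⟨h1, h2⟩)
      · obtain rfl := Subtype.ext h1
        obtain rfl := Subtype.ext h2
        exact ⟨hxy, Or.inl ⟨rfl, rfl⟩⟩
      · obtain rfl := Subtype.ext h1
        obtain rfl := Subtype.ext h2
        exact ⟨(isExchange_matroidRel hr).symm _ _ hxy, Or.inr ⟨rfl, rfl⟩⟩
  have hne : (x, y) ≠ (y, x) := fun h => hxy.1 (congrArg Subtype.val (Prod.ext_iff.1 h).1)
  rw [hset, Finset.sum_pair hne, pairing_posetQSym _ (baseLabeling_strict M _),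
    basePoset_lt_eq hxy, ← (isExchange_matroidRel hr).pairLT_comm x y, two_mul]

theorem basePairs_matroidRel_nonempty [Fintype M.E] (hr : M.eRank = 2) :
    (basePairs (matroidRel M)).Nonempty := by
  obtain ⟨B, hB⟩ := M.exists_isBase
  obtain ⟨x, y, hxy, -⟩ := exists_eq_pair_of_isBase hr hB
  exact ⟨(x, y), mem_basePairs.2 hxy⟩

theorem indep_image_of_matroidRel (hM : M.eRank = 2) (e : M.E ≃ N.E)
    (he : ∀ x y, matroidRel M x y → matroidRel N (e x) (e y)) {I : Set M.E}
    (hI : M.Indep (Subtype.val '' I)) : N.Indep (Subtype.val '' (e '' I)) := by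
  obtain ⟨B, hB, hsub⟩ := hI.exists_isBase_superset
  obtain ⟨x, y, hxy, rfl⟩ := exists_eq_pair_of_isBase hM hB
  refine (he x y hxy).2.indep.subset ?_
  rintro _ ⟨_, ⟨z, hz, rfl⟩, rfl⟩
  rcases hsub ⟨z, hz, rfl⟩ with h | h
  · rw [Subtype.ext h]
    simp
  · rw [Subtype.ext h]
    simp

theorem isomorphic_of_equiv (hM : M.eRank = 2) (hN : N.eRank = 2) (e : M.E ≃ N.E)
    (he : ∀ x y, matroidRel M x y ↔ matroidRel N (e x) (e y)) : Isomorphic M N :=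
  ⟨e, fun I => ⟨fun h => indep_image_of_matroidRel hM e (fun x y => (he x y).1) h, fun h => by
    have := indep_image_of_matroidRel hN e.symm
      (fun x y hxy => (he _ _).2 (by simpa using hxy)) h
    rwa [e.symm_image_image] at this⟩⟩

/-- There are no loops: a circuit through `x` and another element properly contains {x}. -/
theorem exists_matroidRel_of_isConnected (hr : M.eRank = 2) (hc : IsConnected M) (x : M.E) :
    ∃ y, matroidRel M x y := by
  have hind : M.Indep {(x : α)} := by
    obtain ⟨B, hB⟩ := M.exists_isBase
    obtain ⟨p, q, hpq, -⟩ := exists_eq_pair_of_isBase hr hB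
    obtain ⟨y, hyx⟩ : ∃ y : M.E, x ≠ y := by
      by_contra! h
      exact hpq.1 (by rw [← h p, ← h q])
    obtain ⟨C, hC, hx, hy⟩ := (hc.2 x x.2 y y.2).resolve_left fun h => hyx (Subtype.ext h)
    refine hC.ssubset_indep ⟨by simpa using hx, fun h => hyx (Subtype.ext ?_)⟩
    exact (h hy).symm
  obtain ⟨B, hB, hsub⟩ := hind.exists_isBase_superset
  obtain ⟨p, q, hpq, rfl⟩ := exists_eq_pair_of_isBase hr hB
  rcases hsub rfl with h | h
  · rw [Subtype.ext h]
    exact ⟨q, hpq⟩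
  · rw [Subtype.ext h]
    exact ⟨p, (isExchange_matroidRel hr).symm _ _ hpq⟩

/-- A circuit through `x` and `y` has a third element `z`, since {x, y} is independent. Each of {x,
z} and {y, z} omits an element of the circuit, so it is independent and, by its size, a base. -/
theorem exists_third_of_isConnected (hr : M.eRank = 2) (hc : IsConnected M) (x y : M.E)
    (hxy : matroidRel M x y) : ∃ z, matroidRel M x z ∧ matroidRel M y z := by
  obtain ⟨C, hC, hx, hy⟩ := (hc.2 x x.2 y y.2).resolve_left hxy.1
  obtain ⟨z, hz, hzxy⟩ : ∃ z ∈ C, z ∉ ({(x : α), (y : α)} : Set α) := by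
    by_contra! h
    exact hC.not_indep (hxy.2.indep.subset h)
  simp only [Set.mem_insert_iff, Set.mem_singleton_iff, not_or] at hzxy
  have hpair : ∀ p q : α, p ∈ C → p ≠ z → q ∈ C → q ≠ p → q ≠ z → M.IsBase {p, z} := by
    intro p q hp hpz hq hqp hqz
    refine isBase_of_indep_pair hr hpz (hC.ssubset_indep ⟨?_, fun h => ?_⟩)
    · rintro w (rfl | rfl)
      · exact hp
      · exact hz
    · rcases h hq with h | h
      · exact hqp h
      · exact hqz h
  exact ⟨⟨z, hC.subset_ground hz⟩,
    ⟨Ne.symm hzxy.1, hpair x y hx (Ne.symm hzxy.1) hy hxy.1.symm (Ne.symm hzxy.2)⟩,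
    ⟨Ne.symm hzxy.2, hpair y x hy (Ne.symm hzxy.2) hx hxy.1 (Ne.symm hzxy.1)⟩⟩

end RankTwoMatroid

/-! ### The two injectivity statements -/

theorem F_injOn_rankTwo : Set.InjOn F.{u} rankTwo.{u} := by
  rintro _ ⟨M, hM, rfl⟩ _ ⟨N, hN, rfl⟩ h
  rw [F_of, F_of] at h
  let _ : Fintype M.matroid.E := M.finite.ground_finite.fintype
  let _ : Fintype N.matroid.E := N.finite.ground_finite.fintype
  have hbM := isExchange_matroidRel hM
  have hbN := isExchange_matroidRel hN
  obtain ⟨hl, hc⟩ := invariants_eq hbM hbN (basePairs_matroidRel_nonempty hM) fun w => by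
    rw [← two_mul_pairing_matroidQSym hM, ← two_mul_pairing_matroidQSym hN, h]
  obtain ⟨e, he⟩ := exists_equiv_of_classCount_eq hbM hbN hl hc
  exact congrArg (fun c => Finsupp.single c 1) (Quotient.sound (isomorphic_of_equiv hM hN e he))

theorem Fbar_injOn_rankTwoConn : Set.InjOn Fbar.{u} rankTwoConn.{u} := by
  rintro ⟨_, hx⟩ ⟨M, hcM, hM, rfl⟩ ⟨_, hy⟩ ⟨N, hcN, hN, rfl⟩ h
  have hmem : matroidQSym M.matroid - matroidQSym N.matroid ∈ maximalIdeal ^ 2 := by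
    rw [← F_of, ← F_of]
    exact Ideal.Quotient.eq.1 h
  let _ : Fintype M.matroid.E := M.finite.ground_finite.fintype
  let _ : Fintype N.matroid.E := N.finite.ground_finite.fintype
  have hbM := isExchange_matroidRel hM
  have hbN := isExchange_matroidRel hN
  have hlM := exists_matroidRel_of_isConnected hM hcM
  have hlN := exists_matroidRel_of_isConnected hN hcN
  -- The two functions agree only modulo 𝔪², so only primitive elements may be evaluated.
  have hprim : ∀ w, IsPrimitive w → basePairsValue (matroidRel M.matroid) w =
      basePairsValue (matroidRel N.matroid) w := fun w hw => by
    have := pairing_eq_zero_of_mem hw hmem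
    rw [map_sub, sub_eq_zero] at this
    rw [← two_mul_pairing_matroidQSym hM, ← two_mul_pairing_matroidQSym hN, this]
  have hsub : ∀ {E : Type u} [Fintype E] (b : E → E → Prop) (v w : WordAlgebra),
      basePairsValue b (v - w) = basePairsValue b v - basePairsValue b w := fun b v w => by
    simp [basePairsValue]
  have hc := classCount_eq_of_commutator hbM hbN hlM hlN (exists_third_of_isConnected hM hcM)
    (exists_third_of_isConnected hN hcN) (basePairs_matroidRel_nonempty hM) fun a c => by
      rw [← hsub, ← hsub]
      exact hprim _ ((isPrimitive_powerSum a).commutator (isPrimitive_powerSum c))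
  have hall : ∀ {E : Type u} [Fintype E] {b : E → E → Prop}, (∀ x, ∃ y, b x y) →
      nonloops b = univ := fun hl => by
    ext x
    simp [mem_nonloops, hl]
  obtain ⟨e, he⟩ := exists_equiv_of_classCount_eq hbM hbN (by simp [hall hlM, hall hlN]) hc
  exact Subtype.ext
    (congrArg (fun c => Finsupp.single c 1) (Quotient.sound (isomorphic_of_equiv hM hN e he)))

end
end MatroidQSym

theorem proposition6p6 :
    Set.InjOn MatroidQSym.F.{u} MatroidQSym.rankTwo.{u} ∧
      Set.InjOn MatroidQSym.Fbar.{u} MatroidQSym.rankTwoConn.{u} :=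
  ⟨MatroidQSym.F_injOn_rankTwo, MatroidQSym.Fbar_injOn_rankTwoConn⟩
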